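/- There is an absolute constant $c>0$ such that the following holds. Let $\xi$ be a real sub-Gaussian random variable (that is, $\mathbb{P}[|\xi|>t]\le Ce^{-at^2}$ for all $t\ge 0$, with some constants $a,C>0$) which has a density with respect to Lebesgue measure bounded by $K$. Let $n\ge 1$ and let $G_n$ be a random real $n\times n$ matrix such that the entries of $n^{1/2}G_n$ are independent copies of $\xi$. Let $A\in\mathbb{R}^{n\times n}$ with $\|A\|\le 1$, let $\delta\in(0,1)$, let $K'\in\mathbb{R}$, and let $z\in\mathbb{C}$ with $|z|\le 3\delta K'+3$ and $\operatorname{Im}z\ne 0$. Put $M=A+\delta G_n-zI$. Then, for every real $\epsilon$, \[ \mathbb{P}\big[\|G_n\|\le K'\ \text{and}\ \sigma_n(M)\le\epsilon\big]\le c\,(1+\delta K')\,\frac{\max(K,K^2)\,n^3\epsilon^2}{\delta^2|\operatorname{Im}z|}. \] Here $\|\cdot\|$ is the $\ell^2\to\ell^2$ operator norm and $\sigma_n(M)$ is the smallest singular value of $M$. -/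

import Mathlib

open MeasureTheory ProbabilityTheory
open scoped Matrix.Norms.L2Operator

/-- A real random variable is sub-Gaussian if its tails satisfy
`ℙ(|X| > t) ≤ C exp (-a t ^ 2)` for all `t ≥ 0`, with some constants `a, C > 0`. -/
def IsSubGaussian {Ω : Type*} [MeasurableSpace Ω] (X : Ω → ℝ) (P : Measure Ω) : Prop :=
  ∃ a C : ℝ, 0 < a ∧ 0 < C ∧
    ∀ t : ℝ, 0 ≤ t → P.real {ω | t < |X ω|} ≤ C * Real.exp (-a * t ^ 2)

/-- The law of the real random variable `X` has a density with respect to Lebesgue measure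
which is bounded by `K`. -/
def HasDensityBoundedBy {Ω : Type*} [MeasurableSpace Ω] (X : Ω → ℝ) (P : Measure Ω) (K : ℝ) :
    Prop :=
  AEMeasurable X P ∧ ∃ f : ℝ → ℝ, Measurable f ∧ (∀ x, 0 ≤ f x ∧ f x ≤ K) ∧
    P.map X = volume.withDensity (fun x => ENNReal.ofReal (f x))

/-- The random matrix `G` is distributed as `Gₙ(ξ)`: the entries of `√n G` are independent
copies of `ξ`. -/
structure IsScaledIIDMatrix {Ω Ω' : Type*} [MeasurableSpace Ω] [MeasurableSpace Ω'] {n : ℕ}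
    (G : Ω → Matrix (Fin n) (Fin n) ℝ) (P : Measure Ω) (ξ : Ω' → ℝ) (P' : Measure Ω') :
    Prop where
  indep : iIndepFun (fun (p : Fin n × Fin n) (ω : Ω) => √(n : ℝ) * G ω p.1 p.2) P
  copies : ∀ i j : Fin n, IdentDistrib (fun ω => √(n : ℝ) * G ω i j) ξ P P'

/-- The least singular value `σₙ(M)` of a complex `n × n` matrix, `n ≥ 1`. Mathlib's singular
values are nonincreasing and indexed from `0`, so this is the one of index `n - 1`. -/
noncomputable def leastSingularValue {n : ℕ} (M : Matrix (Fin n) (Fin n) ℂ) : ℝ :=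
  (Matrix.toEuclideanLin M).singularValues (n - 1)

/-! If `M` nearly kills a unit vector `v`, some entry satisfies `|v i| ≥ n^{-1/2}`; a union over `i`
costs a factor `n`. Fix `i` and all columns of `M` but the `i`-th, and let `u` be a unit vector
annihilating the fixed columns. Pairing `u` with `M v` gives `|u · M_i| ≤ ε √n`. The random part of
`M_i` is `δ / √n` times a vector `y` of independent variables of density at most `K`, so the real
forms `p · y` and `q · y`, with `u = p + i q`, both lie in fixed intervals of half-length `s = ε n /
δ`.

A phase change makes `p ⊥ q` and `|p| ≥ |q|`, hence `|p|² ≥ 1/2`. A planar small ball estimate then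
bounds the probability by `O(K² s² / (|p| |q|))`. The vector `q` cannot be too short: `A + δ G` is
real of norm at most `R = 1 + δ K'`, and taking imaginary parts in `u M ≈ 0` expresses `Im z · p`
through `q`, so that `|Im z| = O(R |q|)`. This needs `4 ε √n ≤ |Im z|`. Otherwise `s ≥ |Im z| / 4`,
and the bound `O(K s)` from the single form `p · y` is already enough. The two cases produce `max(K,
K²)`.

The small ball estimates must be free of dimension. Esseen's inequality reduces them to integrals of
products of characteristic functions `φ`. Hölder's inequality separates the factors and calls for `∫
|φ|^p = O(K / √p)`, which follows from the `L²` bound and from the smallness of the set where `|φ|`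
is close to `1`. In the plane, Hölder is applied over pairs of coordinates weighted by squared
determinants. A coordinate too heavy for Hölder is integrated out directly using its bounded
density. -/

section CharFun

/-! ### Integrability of powers of the characteristic function of a bounded density. -/

lemma abs_sin_nat_mul_le (k : ℕ) (x : ℝ) : |Real.sin (k * x)| ≤ k * |Real.sin x| := by
  induction k with
  | zero => simp
  | succ k ih =>
    have h1 : Real.sin ((k + 1 : ℕ) * x)
        = Real.sin (k * x) * Real.cos x + Real.cos (k * x) * Real.sin x := by
      rw [← Real.sin_add]; push_cast; ring_nf
    rw [h1]
    calc _ ≤ |Real.sin (k * x)| * |Real.cos x| + |Real.cos (k * x)| * |Real.sin x| := by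
            rw [← abs_mul, ← abs_mul]; exact abs_add_le _ _
      _ ≤ |Real.sin (k * x)| * 1 + 1 * |Real.sin x| := by
            gcongr <;> exact Real.abs_cos_le_one _
      _ ≤ _ := by push_cast; linarith

lemma one_sub_cos_nat_mul_le (k : ℕ) (x : ℝ) :
    1 - Real.cos (k * x) ≤ k ^ 2 * (1 - Real.cos x) := by
  have h (y : ℝ) : 1 - Real.cos y = 2 * |Real.sin (y / 2)| ^ 2 := by
    have := Real.cos_two_mul (y / 2)
    rw [mul_div_cancel₀ y two_ne_zero] at this
    rw [sq_abs, Real.sin_sq, this]; ring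
  have h2 : |Real.sin (k * x / 2)| ^ 2 ≤ (k * |Real.sin (x / 2)|) ^ 2 := by
    rw [mul_div_assoc]
    gcongr
    exact abs_sin_nat_mul_le k (x / 2)
  rw [h, h]
  nlinarith

variable {μ : Measure ℝ} [IsProbabilityMeasure μ]

/-- `|φ|²` is the characteristic function of the symmetrization `X - X'`, which is real. -/
lemma norm_charFun_sq_eq_integral_cos (t : ℝ) :
    ‖charFun μ t‖ ^ 2 = ∫ p, Real.cos (t * (p.1 - p.2)) ∂(μ.prod μ) := by
  have h1 : ((‖charFun μ t‖ ^ 2 : ℝ) : ℂ)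
      = ∫ p : ℝ × ℝ, Complex.exp ((t * (p.1 - p.2) : ℝ) * Complex.I) ∂(μ.prod μ) := by
    have : ((‖charFun μ t‖ ^ 2 : ℝ) : ℂ) = charFun μ t * charFun μ (-t) := by
      rw [charFun_neg, Complex.mul_conj, Complex.normSq_eq_norm_sq]
    rw [this, charFun_apply_real, charFun_apply_real, ← integral_prod_mul]
    congr 1 with p
    rw [← Complex.exp_add]
    congr 1
    push_cast
    ring
  have h2 := congrArg Complex.re h1
  rw [Complex.ofReal_re] at h2
  rw [h2]
  have hint : Integrable (fun p : ℝ × ℝ => Complex.exp ((t * (p.1 - p.2) : ℝ) * Complex.I))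
      (μ.prod μ) := by
    refine Integrable.of_bound (C := 1) ?_ (ae_of_all _ fun p => ?_)
    · exact (by fun_prop : Continuous _).aestronglyMeasurable
    · rw [Complex.norm_exp_ofReal_mul_I]
  have h3 := integral_re hint
  rw [← RCLike.re_eq_complex_re, ← h3]
  congr 1 with p
  rw [RCLike.re_eq_complex_re, Complex.exp_ofReal_mul_I_re]

/-- If `|φ|²` is very close to `1` at `t`, it is still close to `1` at the dilated point `k t`. This
is what makes the near-maximum set small. -/
lemma one_sub_norm_charFun_sq_nat_mul_le (k : ℕ) (t : ℝ) :
    1 - ‖charFun μ (k * t)‖ ^ 2 ≤ k ^ 2 * (1 - ‖charFun μ t‖ ^ 2) := by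
  have hint (s : ℝ) : Integrable (fun p : ℝ × ℝ => Real.cos (s * (p.1 - p.2))) (μ.prod μ) := by
    refine Integrable.of_bound (C := 1) ?_ (ae_of_all _ fun p => ?_)
    · exact (by fun_prop : Continuous _).aestronglyMeasurable
    · exact Real.abs_cos_le_one _
  have h (s : ℝ) : 1 - ‖charFun μ s‖ ^ 2
      = ∫ p : ℝ × ℝ, (1 - Real.cos (s * (p.1 - p.2))) ∂(μ.prod μ) := by
    rw [norm_charFun_sq_eq_integral_cos, integral_sub (integrable_const _) (hint s)]
    simp
  rw [h, h, ← integral_const_mul]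
  refine integral_mono ((integrable_const _).sub (hint _))
    (((integrable_const _).sub (hint _)).const_mul _) fun p => ?_
  have := one_sub_cos_nat_mul_le k (t * (p.1 - p.2))
  simpa [mul_assoc] using this

lemma lintegral_exp_neg_sq_prod_le {K : ℝ} (hK : 0 ≤ K) (hμ : μ ≤ ENNReal.ofReal K • volume)
    {v : ℝ} (hv : 0 < v) :
    ∫⁻ p, ENNReal.ofReal (Real.exp (-v * (p.1 - p.2) ^ 2)) ∂(μ.prod μ)
      ≤ ENNReal.ofReal (K * √(Real.pi / v)) := by
  rw [lintegral_prod_symm _ (by fun_prop)]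
  calc _ ≤ ∫⁻ _ : ℝ, ENNReal.ofReal (K * √(Real.pi / v)) ∂μ := by
        refine lintegral_mono fun y => ?_
        calc _ ≤ ∫⁻ x, ENNReal.ofReal (Real.exp (-v * (x - y) ^ 2)) ∂(ENNReal.ofReal K • volume) :=
              lintegral_mono' hμ le_rfl
          _ = ENNReal.ofReal K * ∫⁻ x, ENNReal.ofReal (Real.exp (-v * (x - y) ^ 2)) := by
              rw [lintegral_smul_measure, smul_eq_mul]
          _ = ENNReal.ofReal K * ∫⁻ x, ENNReal.ofReal (Real.exp (-v * x ^ 2)) := by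
              rw [lintegral_sub_right_eq_self (fun x => ENNReal.ofReal (Real.exp (-v * x ^ 2))) y]
          _ = _ := by
              rw [← ofReal_integral_eq_lintegral_ofReal (integrable_exp_neg_mul_sq hv)
                (ae_of_all _ fun x => (Real.exp_pos _).le), integral_gaussian,
                ENNReal.ofReal_mul hK]
    _ = _ := by simp

/-- A Plancherel identity with Gaussian regularization: averaging the cosine over `t` first leaves a
Gaussian kernel in `x - y`, which a bounded density controls. -/
lemma integral_norm_charFun_sq_gaussianReal (v : NNReal) :
    ∫ t, ‖charFun μ t‖ ^ 2 ∂(gaussianReal 0 v)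
      = ∫ p, Real.exp (-(v / 2 : ℝ) * (p.1 - p.2) ^ 2) ∂(μ.prod μ) := by
  simp_rw [norm_charFun_sq_eq_integral_cos]
  rw [integral_integral_swap]
  · congr 1 with p
    have h1 := charFun_gaussianReal (μ := 0) (v := v) (p.1 - p.2)
    rw [charFun_apply_real] at h1
    have hint : Integrable (fun t : ℝ => Complex.exp ((p.1 - p.2 : ℝ) * (t : ℂ) * Complex.I))
        (gaussianReal 0 v) := by
      refine Integrable.of_bound (C := 1) ?_ (ae_of_all _ fun t => ?_)
      · exact (by fun_prop : Continuous _).aestronglyMeasurable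
      · rw [← Complex.ofReal_mul, Complex.norm_exp_ofReal_mul_I]
    have h2 := integral_re hint
    have h3 := congrArg Complex.re h1
    rw [← RCLike.re_eq_complex_re, ← h2] at h3
    convert h3 using 1
    · congr 1 with t
      rw [RCLike.re_eq_complex_re, ← Complex.ofReal_mul, Complex.exp_ofReal_mul_I_re, mul_comm]
    · rw [RCLike.re_eq_complex_re, ← Complex.exp_ofReal_re]
      congr 2
      push_cast
      ring
  · refine Integrable.of_bound (C := 1) ?_ (ae_of_all _ fun p => ?_)
    · exact (by unfold Function.uncurry; fun_prop : Continuous _).aestronglyMeasurable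
    · exact Real.abs_cos_le_one _

/-- The `L²` bound for the characteristic function of a law with density at most `K`. -/
lemma lintegral_norm_charFun_sq_le {K : ℝ} (hK : 0 ≤ K) (hμ : μ ≤ ENNReal.ofReal K • volume) :
    ∫⁻ t, ENNReal.ofReal (‖charFun μ t‖ ^ 2) ≤ ENNReal.ofReal (2 * Real.pi * K) := by
  have hmeas : Measurable (fun t => ENNReal.ofReal (‖charFun μ t‖ ^ 2)) := by
    have : Measurable (charFun μ) := measurable_charFun
    fun_prop
  -- The Gaussian weight of variance `m + 1`, normalized to equal `1` at the origin, gives a bound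
  -- uniform in `m`; Fatou's lemma then removes the weight.
  have key (m : ℕ) : ∫⁻ t, ENNReal.ofReal (Real.exp (-t ^ 2 / (2 * (m + 1 : ℝ)))) *
      ENNReal.ofReal (‖charFun μ t‖ ^ 2) ≤ ENNReal.ofReal (2 * Real.pi * K) := by
    set v : NNReal := (m : NNReal) + 1 with hv
    have hv0 : (0 : ℝ) < v := by positivity
    have hvr : (v : ℝ) = m + 1 := by simp [hv]
    have h1 : ∫⁻ t, ENNReal.ofReal (‖charFun μ t‖ ^ 2) ∂(gaussianReal 0 v)
        ≤ ENNReal.ofReal (K * √(Real.pi / (v / 2))) := by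
      rw [← ofReal_integral_eq_lintegral_ofReal]
      · rw [integral_norm_charFun_sq_gaussianReal, ofReal_integral_eq_lintegral_ofReal]
        · exact lintegral_exp_neg_sq_prod_le hK hμ (by positivity)
        · refine Integrable.of_bound (C := 1) ?_ (ae_of_all _ fun p => ?_)
          · exact (by fun_prop : Continuous _).aestronglyMeasurable
          · rw [Real.norm_eq_abs, abs_of_pos (Real.exp_pos _), Real.exp_le_one_iff]
            have := sq_nonneg (p.1 - p.2)
            nlinarith
        · exact ae_of_all _ fun p => (Real.exp_pos _).le
      · refine Integrable.of_bound (C := 1) ?_ (ae_of_all _ fun t => ?_)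
        · have : Measurable (charFun μ) := measurable_charFun
          exact (by fun_prop : Measurable _).aestronglyMeasurable
        · rw [norm_pow, norm_norm]
          exact pow_le_one₀ (norm_nonneg _) (norm_charFun_le_one t)
      · exact ae_of_all _ fun p => by positivity
    rw [gaussianReal_of_var_ne_zero _ (by positivity),
      lintegral_withDensity_eq_lintegral_mul _ (measurable_gaussianPDF 0 v) hmeas] at h1
    have h2 (t : ℝ) : ENNReal.ofReal (Real.exp (-t ^ 2 / (2 * (m + 1 : ℝ))))
        = ENNReal.ofReal (√(2 * Real.pi * v)) * gaussianPDF 0 v t := by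
      rw [gaussianPDF, gaussianPDFReal, ← ENNReal.ofReal_mul (by positivity), ← mul_assoc,
        mul_inv_cancel₀ (by positivity), one_mul, hvr, sub_zero]
    have h3 : ∫⁻ t, ENNReal.ofReal (Real.exp (-t ^ 2 / (2 * (m + 1 : ℝ)))) *
        ENNReal.ofReal (‖charFun μ t‖ ^ 2) = ENNReal.ofReal (√(2 * Real.pi * v)) *
          ∫⁻ t, (gaussianPDF 0 v * fun t => ENNReal.ofReal (‖charFun μ t‖ ^ 2)) t := by
      rw [← lintegral_const_mul _ ((measurable_gaussianPDF 0 v).mul hmeas)]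
      congr 1 with t
      rw [h2, mul_assoc, Pi.mul_apply]
    rw [h3]
    calc _ ≤ ENNReal.ofReal (√(2 * Real.pi * v)) * ENNReal.ofReal (K * √(Real.pi / (v / 2))) := by
          gcongr
      _ = _ := by
          rw [← ENNReal.ofReal_mul (by positivity)]
          congr 1
          have : √(2 * Real.pi * v) * √(Real.pi / (v / 2)) = 2 * Real.pi := by
            rw [← Real.sqrt_mul (by positivity)]
            rw [show 2 * Real.pi * v * (Real.pi / (v / 2)) = (2 * Real.pi) ^ 2 by field_simp]
            exact Real.sqrt_sq (by positivity)
          calc _ = (√(2 * Real.pi * v) * √(Real.pi / (v / 2))) * K := by ring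
            _ = _ := by rw [this]
  have hlim (t : ℝ) : Filter.Tendsto (fun m : ℕ => ENNReal.ofReal
      (Real.exp (-t ^ 2 / (2 * (m + 1 : ℝ)))) * ENNReal.ofReal (‖charFun μ t‖ ^ 2)) Filter.atTop
      (nhds (ENNReal.ofReal (‖charFun μ t‖ ^ 2))) := by
    have h1 : Filter.Tendsto (fun m : ℕ => -t ^ 2 / (2 * (m + 1 : ℝ))) Filter.atTop (nhds 0) := by
      have := (tendsto_one_div_add_atTop_nhds_zero_nat (𝕜 := ℝ)).const_mul (-t ^ 2 / 2)
      rw [mul_zero] at this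
      refine this.congr fun m => ?_
      field_simp
    have h2 := ENNReal.tendsto_ofReal ((Real.continuous_exp.tendsto 0).comp h1)
    have h3 := ENNReal.Tendsto.mul_const (b := ENNReal.ofReal (‖charFun μ t‖ ^ 2)) h2
      (Or.inr ENNReal.ofReal_ne_top)
    simpa using h3
  calc ∫⁻ t, ENNReal.ofReal (‖charFun μ t‖ ^ 2)
      = ∫⁻ t, Filter.liminf (fun m : ℕ => ENNReal.ofReal
        (Real.exp (-t ^ 2 / (2 * (m + 1 : ℝ)))) * ENNReal.ofReal (‖charFun μ t‖ ^ 2))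
        Filter.atTop := by
        congr 1 with t
        exact (hlim t).liminf_eq.symm
    _ ≤ Filter.liminf (fun m : ℕ => ∫⁻ t, ENNReal.ofReal
        (Real.exp (-t ^ 2 / (2 * (m + 1 : ℝ)))) * ENNReal.ofReal (‖charFun μ t‖ ^ 2))
        Filter.atTop := lintegral_liminf_le fun m => Measurable.mul (by fun_prop) hmeas
    _ ≤ _ := Filter.liminf_le_of_frequently_le' (Filter.Frequently.of_forall key)

/-- The set where `|φ|²` is within `x` of `1` has measure `O(K √x)`. -/
lemma volume_one_sub_norm_charFun_sq_le {K : ℝ} (hK : 0 ≤ K)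
    (hμ : μ ≤ ENNReal.ofReal K • volume) {x : ℝ} (hx : 0 < x) (hx2 : x ≤ 1 / 2) :
    volume {t | 1 - ‖charFun μ t‖ ^ 2 ≤ x} ≤ ENNReal.ofReal (16 * Real.pi * K * √x) := by
  have hmeas : Measurable (fun t => ENNReal.ofReal (‖charFun μ t‖ ^ 2)) := by
    have : Measurable (charFun μ) := measurable_charFun
    fun_prop
  have hhalf : volume {t | (1 / 2 : ℝ) ≤ ‖charFun μ t‖ ^ 2} ≤ ENNReal.ofReal (4 * Real.pi * K) := by
    have h1 := mul_meas_ge_le_lintegral (μ := volume) hmeas (ENNReal.ofReal (1 / 2))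
    have h2 := h1.trans (lintegral_norm_charFun_sq_le hK hμ)
    calc _ ≤ volume {t | ENNReal.ofReal (1 / 2) ≤ ENNReal.ofReal (‖charFun μ t‖ ^ 2)} :=
          measure_mono fun t ht => ENNReal.ofReal_le_ofReal ht
      _ = ENNReal.ofReal 2 * (ENNReal.ofReal (1 / 2) *
          volume {t | ENNReal.ofReal (1 / 2) ≤ ENNReal.ofReal (‖charFun μ t‖ ^ 2)}) := by
          rw [← mul_assoc, ← ENNReal.ofReal_mul (by norm_num)]
          norm_num
      _ ≤ ENNReal.ofReal 2 * ENNReal.ofReal (2 * Real.pi * K) := by gcongr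
      _ = _ := by
          rw [← ENNReal.ofReal_mul (by norm_num)]
          congr 1
          ring
  -- With `k = ⌊y⌋` one has `k² x ≤ 1/2`, so dilation by `k` sends the set into `{|φ|² ≥ 1/2}`,
  -- whose measure is `O(K)` by Markov. The dilation gains `1 / k = O(√x)`, since `k ≥ 1` gives `y <
  -- k + 1 ≤ 2 k`.
  set y : ℝ := 1 / √(2 * x) with hy
  have hsq : 0 < √(2 * x) := by positivity
  have hy1 : 1 ≤ y := by
    rw [hy, le_div_iff₀ hsq, one_mul]
    exact Real.sqrt_le_one.mpr (by linarith)
  set k : ℕ := ⌊y⌋₊ with hk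
  have hk1 : 1 ≤ k := Nat.le_floor (by simpa using hy1)
  have hk1' : (1 : ℝ) ≤ k := by exact_mod_cast hk1
  have hky : (k : ℝ) ≤ y := Nat.floor_le (by positivity)
  have hyk : y < k + 1 := Nat.lt_floor_add_one y
  have hkx : (k : ℝ) ^ 2 * x ≤ 1 / 2 := by
    calc (k : ℝ) ^ 2 * x ≤ y ^ 2 * x := by gcongr
      _ = 1 / 2 := by
        rw [hy, div_pow, Real.sq_sqrt (by positivity)]
        field_simp
  calc volume {t | 1 - ‖charFun μ t‖ ^ 2 ≤ x}
      ≤ volume ((fun t => (k : ℝ) * t) ⁻¹' {t | (1 / 2 : ℝ) ≤ ‖charFun μ t‖ ^ 2}) := by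
        refine measure_mono fun t ht => ?_
        have h1 := one_sub_norm_charFun_sq_nat_mul_le (μ := μ) k t
        have h2 : (k : ℝ) ^ 2 * (1 - ‖charFun μ t‖ ^ 2) ≤ k ^ 2 * x := by
          gcongr
          exact ht
        change (1 / 2 : ℝ) ≤ ‖charFun μ (k * t)‖ ^ 2
        linarith
    _ = ENNReal.ofReal |(k : ℝ)⁻¹| * volume {t | (1 / 2 : ℝ) ≤ ‖charFun μ t‖ ^ 2} :=
        Real.volume_preimage_mul_left (by positivity) _
    _ ≤ ENNReal.ofReal |(k : ℝ)⁻¹| * ENNReal.ofReal (4 * Real.pi * K) := by gcongr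
    _ = ENNReal.ofReal (|(k : ℝ)⁻¹| * (4 * Real.pi * K)) := by
        rw [← ENNReal.ofReal_mul (by positivity)]
    _ ≤ _ := by
        refine ENNReal.ofReal_le_ofReal ?_
        rw [abs_of_pos (by positivity)]
        have h1 : (k : ℝ)⁻¹ ≤ 4 * √x := by
          have h2 : y ≤ 2 * k := by linarith
          have h3 : (k : ℝ)⁻¹ ≤ 2 * √(2 * x) := by
            rw [hy, div_le_iff₀ hsq] at h2
            rw [inv_le_iff_one_le_mul₀ (by positivity)]
            linarith
          have h4 : √(2 * x) ≤ 2 * √x := by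
            rw [Real.sqrt_mul (by norm_num)]
            gcongr
            rw [Real.sqrt_le_left (by norm_num)]
            norm_num
          linarith
        have h5 : 0 ≤ 4 * Real.pi * K := by positivity
        nlinarith [mul_le_mul_of_nonneg_right h1 h5]

lemma summable_exp_neg_half_mul_sqrt :
    Summable (fun m : ℕ => Real.exp (-(m / 2 : ℝ)) * √(m + 1)) := by
  have h1 := Real.summable_pow_mul_exp_neg_nat_mul 1 (r := 1 / 2) (by norm_num)
  have h2 := Real.summable_pow_mul_exp_neg_nat_mul 0 (r := 1 / 2) (by norm_num)
  refine Summable.of_nonneg_of_le (fun m => by positivity) (fun m => ?_) (h1.add h2)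
  have h3 : √((m : ℝ) + 1) ≤ m + 1 := by
    rw [Real.sqrt_le_left (by positivity)]
    nlinarith [(Nat.cast_nonneg m : (0 : ℝ) ≤ m)]
  have h4 : Real.exp (-(1 / 2) * (m : ℝ)) = Real.exp (-(m / 2 : ℝ)) := by congr 1; ring
  rw [h4]
  nlinarith [mul_le_mul_of_nonneg_left h3 (Real.exp_pos (-(m / 2 : ℝ))).le]

lemma half_rpow_le_two_div_sqrt {p : ℝ} (hp : 2 ≤ p) :
    (1 / 2 : ℝ) ^ ((p - 2) / 2) ≤ 2 / √p := by
  have hlog : (1 / 2 : ℝ) ≤ Real.log 2 := by linarith [Real.log_two_gt_d9]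
  have h1 : (1 / 2 : ℝ) ^ ((p - 2) / 2) ≤ (Real.exp ((p - 2) / 4))⁻¹ := by
    rw [Real.rpow_def_of_pos (by norm_num), ← Real.exp_neg, Real.exp_le_exp, one_div, Real.log_inv]
    nlinarith
  have h2 : √p / 2 ≤ Real.exp ((p - 2) / 4) := by
    have h3 := Real.add_one_le_exp ((p - 2) / 4)
    have h4 := Real.sq_sqrt (by linarith : 0 ≤ p)
    nlinarith [sq_nonneg (√p - 1)]
  have hp0 : 0 < √p := Real.sqrt_pos.mpr (by linarith)
  calc _ ≤ (Real.exp ((p - 2) / 4))⁻¹ := h1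
    _ ≤ (√p / 2)⁻¹ := inv_anti₀ (by positivity) h2
    _ = _ := by rw [inv_div]

/-- Put `D = 1 - |φ|²`. Where `D > 1/2`, all but two of the `p` powers decay exponentially in `p`.
Elsewhere `|φ|^p ≤ exp (-p D / 2)`, and the layer `m = ⌊p D⌋` gives the weight `exp (-m / 2)`. The
layers have measure `O(K √((m + 1) / p))`, so their sum converges at the scale `K / √p`. -/
lemma norm_charFun_rpow_le_tsum {p : ℝ} (hp : 2 ≤ p) (t : ℝ) :
    ENNReal.ofReal (‖charFun μ t‖ ^ p) ≤
      ENNReal.ofReal (2 / √p) * ENNReal.ofReal (‖charFun μ t‖ ^ 2) +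
      ∑' m : ℕ, ENNReal.ofReal (Real.exp (-(m / 2 : ℝ))) *
        {t | 1 - ‖charFun μ t‖ ^ 2 ≤ min ((m + 1) / p) (1 / 2)}.indicator 1 t := by
  set c := ‖charFun μ t‖ with hc
  have hc0 : 0 ≤ c := norm_nonneg _
  have hc1 : c ≤ 1 := norm_charFun_le_one t
  have hcsq : c ^ 2 ≤ 1 := pow_le_one₀ hc0 hc1
  by_cases h : 1 - c ^ 2 ≤ 1 / 2
  · set D := 1 - c ^ 2 with hD
    have hD0 : 0 ≤ D := by linarith
    set m : ℕ := ⌊p * D⌋₊ with hm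
    have hmle : (m : ℝ) ≤ p * D := Nat.floor_le (by positivity)
    have hmlt : p * D < m + 1 := Nat.lt_floor_add_one _
    refine le_add_left (le_trans ?_ (ENNReal.le_tsum m))
    have hmem : t ∈ {t | 1 - ‖charFun μ t‖ ^ 2 ≤ min ((m + 1) / p) (1 / 2)} := by
      refine le_min ?_ h
      rw [le_div_iff₀ (by linarith)]
      change D * p ≤ _
      linarith
    rw [Set.indicator_of_mem hmem, Pi.one_apply, mul_one]
    refine ENNReal.ofReal_le_ofReal ?_
    have h1 : c ^ p = (c ^ 2) ^ (p / 2) := by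
      rw [← Real.rpow_natCast, ← Real.rpow_mul hc0]
      congr 1
      push_cast
      ring
    have h2 : c ^ 2 ≤ Real.exp (-D) := by
      have := Real.add_one_le_exp (-D)
      linarith
    calc c ^ p = (c ^ 2) ^ (p / 2) := h1
      _ ≤ (Real.exp (-D)) ^ (p / 2) := by gcongr
      _ = Real.exp (-D * (p / 2)) := by rw [← Real.exp_mul]
      _ ≤ _ := by
        rw [Real.exp_le_exp]
        linarith
  · refine le_add_right ?_
    rw [← ENNReal.ofReal_mul (by positivity)]
    refine ENNReal.ofReal_le_ofReal ?_
    push Not at h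
    have h1 : c ^ p = (c ^ 2) ^ ((p - 2) / 2) * c ^ 2 := by
      rw [← Real.rpow_natCast, ← Real.rpow_mul hc0]
      rw [← Real.rpow_add_of_nonneg hc0 (by push_cast; linarith) (by positivity)]
      congr 1
      push_cast
      ring
    rw [h1]
    gcongr
    refine le_trans ?_ (half_rpow_le_two_div_sqrt hp)
    exact Real.rpow_le_rpow (by positivity) (by linarith) (by linarith)

/-- If `μ` has density at most `K`, then `∫ |φ|ᵖ = O(K / √p)` for `p ≥ 2`, written with
`r = 1 / p`. -/
lemma exists_lintegral_enorm_charFun_rpow_le : ∃ C : ℝ, 0 < C ∧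
    ∀ (μ : Measure ℝ) [IsProbabilityMeasure μ] (K : ℝ), 0 ≤ K → μ ≤ ENNReal.ofReal K • volume →
      ∀ r : ℝ, 0 < r → r ≤ 1 / 2 →
        ∫⁻ t, ‖charFun μ t‖ₑ ^ (1 / r) ≤ ENNReal.ofReal (C * K * √r) := by
  set S : ℝ := ∑' m : ℕ, Real.exp (-(m / 2 : ℝ)) * √(m + 1) with hS
  have hS0 : 0 ≤ S := tsum_nonneg fun m => by positivity
  refine ⟨4 * Real.pi + 16 * Real.pi * S, by positivity, ?_⟩
  intro μ _ K hK hμ r hr hr2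
  set p : ℝ := 1 / r with hp
  have hp2 : 2 ≤ p := by
    rw [hp, le_div_iff₀ hr]
    linarith
  have hp0 : 0 < p := by linarith
  have hsp : 0 < √p := Real.sqrt_pos.mpr hp0
  have hmc : Measurable (charFun μ) := measurable_charFun
  have hset (x : ℝ) : MeasurableSet {t | 1 - ‖charFun μ t‖ ^ 2 ≤ x} :=
    measurableSet_le (by fun_prop) measurable_const
  have hrp : √r = 1 / √p := by
    rw [hp, Real.sqrt_div zero_le_one, Real.sqrt_one, one_div_one_div]
  have h1 (t : ℝ) : ‖charFun μ t‖ₑ ^ p = ENNReal.ofReal (‖charFun μ t‖ ^ p) := by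
    rw [← ofReal_norm, ENNReal.ofReal_rpow_of_nonneg (norm_nonneg _) hp0.le]
  simp_rw [h1]
  calc ∫⁻ t, ENNReal.ofReal (‖charFun μ t‖ ^ p)
      ≤ ∫⁻ t, (ENNReal.ofReal (2 / √p) * ENNReal.ofReal (‖charFun μ t‖ ^ 2) +
        ∑' m : ℕ, ENNReal.ofReal (Real.exp (-(m / 2 : ℝ))) *
        {t | 1 - ‖charFun μ t‖ ^ 2 ≤ min ((m + 1) / p) (1 / 2)}.indicator 1 t) :=
        lintegral_mono fun t => norm_charFun_rpow_le_tsum hp2 t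
    _ = ENNReal.ofReal (2 / √p) * (∫⁻ t, ENNReal.ofReal (‖charFun μ t‖ ^ 2)) +
        ∑' m : ℕ, ENNReal.ofReal (Real.exp (-(m / 2 : ℝ))) *
          volume {t | 1 - ‖charFun μ t‖ ^ 2 ≤ min ((m + 1) / p) (1 / 2)} := by
        rw [lintegral_add_left (by fun_prop), lintegral_const_mul _ (by fun_prop), lintegral_tsum]
        · congr 2
          funext m
          rw [lintegral_const_mul _ (measurable_one.indicator (hset _)),
            lintegral_indicator_one (hset _)]
        · exact fun m => (Measurable.const_mul (measurable_one.indicator (hset _)) _).aemeasurable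
    _ ≤ ENNReal.ofReal (2 / √p) * ENNReal.ofReal (2 * Real.pi * K) +
        ∑' m : ℕ, ENNReal.ofReal (Real.exp (-(m / 2 : ℝ))) *
          ENNReal.ofReal (16 * Real.pi * K * √((m + 1) / p)) := by
        gcongr with m
        · exact lintegral_norm_charFun_sq_le hK hμ
        · refine (volume_one_sub_norm_charFun_sq_le hK hμ (by positivity)
            (min_le_right _ _)).trans (ENNReal.ofReal_le_ofReal ?_)
          gcongr
          exact min_le_left _ _
    _ = ENNReal.ofReal (2 / √p * (2 * Real.pi * K)) +
        ∑' m : ℕ, ENNReal.ofReal (16 * Real.pi * K * √r *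
          (Real.exp (-(m / 2 : ℝ)) * √(m + 1))) := by
        rw [← ENNReal.ofReal_mul (by positivity)]
        congr 2
        funext m
        rw [← ENNReal.ofReal_mul (by positivity), Real.sqrt_div (by positivity), hrp]
        congr 1
        ring
    _ = ENNReal.ofReal (2 / √p * (2 * Real.pi * K)) +
        ENNReal.ofReal (16 * Real.pi * K * √r * S) := by
        rw [hS, ← tsum_mul_left, ENNReal.ofReal_tsum_of_nonneg]
        · exact fun m => by positivity
        · exact summable_exp_neg_half_mul_sqrt.mul_left _
    _ = _ := by
        rw [← ENNReal.ofReal_add (by positivity) (by positivity), hrp]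
        congr 1
        ring

end CharFun

/-! ### Hölder bounds for products of one-variable functions of linear forms. -/

section Hoelder
open scoped ENNReal

lemma lintegral_comp_mul_left_real {f : ℝ → ℝ≥0∞} (hf : Measurable f) {a : ℝ} (ha : a ≠ 0) :
    ∫⁻ t, f (a * t) = ENNReal.ofReal |a⁻¹| * ∫⁻ t, f t := by
  rw [← smul_eq_mul, ← lintegral_smul_measure, ← Real.map_volume_mul_left ha,
    lintegral_map hf (by fun_prop)]

lemma lintegral_mul_comp_linear_two {f g : ℝ → ℝ≥0∞} (hf : Measurable f) (hg : Measurable g)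
    {a b c d : ℝ} (hd : a * d - b * c ≠ 0) :
    ∫⁻ θ : ℝ × ℝ, f (a * θ.1 + b * θ.2) * g (c * θ.1 + d * θ.2)
      = ENNReal.ofReal |(a * d - b * c)⁻¹| * ((∫⁻ t, f t) * ∫⁻ t, g t) := by
  have e := (volume_preserving_finTwoArrow ℝ)
  have hdet : (!![a, b; c, d] : Matrix (Fin 2) (Fin 2) ℝ).det = a * d - b * c :=
    Matrix.det_fin_two_of _ _ _ _
  have h1 := Real.map_matrix_volume_pi_eq_smul_volume_pi
    (M := (!![a, b; c, d] : Matrix (Fin 2) (Fin 2) ℝ)) (by rwa [hdet])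
  rw [hdet] at h1
  have hF : Measurable (fun y : Fin 2 → ℝ => f (y 0) * g (y 1)) := by fun_prop
  calc ∫⁻ θ : ℝ × ℝ, f (a * θ.1 + b * θ.2) * g (c * θ.1 + d * θ.2)
      = ∫⁻ x : Fin 2 → ℝ, f (a * x 0 + b * x 1) * g (c * x 0 + d * x 1) := by
        rw [← e.lintegral_comp (by fun_prop)]
        rfl
    _ = ∫⁻ x : Fin 2 → ℝ, (fun y : Fin 2 → ℝ => f (y 0) * g (y 1))
          (Matrix.toLin' (!![a, b; c, d] : Matrix (Fin 2) (Fin 2) ℝ) x) := by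
        congr 1 with x
        simp [Matrix.toLin'_apply, Matrix.mulVec, dotProduct, Fin.sum_univ_two]
    _ = ENNReal.ofReal |(a * d - b * c)⁻¹| * ∫⁻ y : Fin 2 → ℝ, f (y 0) * g (y 1) := by
        rw [← smul_eq_mul, ← lintegral_smul_measure, ← h1, lintegral_map hF]
        exact (LinearMap.continuous_of_finiteDimensional _).measurable
    _ = _ := by
        congr 1
        rw [← lintegral_prod_mul hf.aemeasurable hg.aemeasurable]
        rw [← Measure.volume_eq_prod, ← e.lintegral_comp (by fun_prop)]
        rfl

lemma ENNReal.prod_rpow_eq_rpow_sum {κ : Type*} [Fintype κ] (x : ℝ≥0∞) (f : κ → ℝ)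
    (hf : ∀ i, 0 ≤ f i) : ∏ i, x ^ f i = x ^ ∑ i, f i := by
  classical
  induction (Finset.univ : Finset κ) using Finset.induction_on with
  | empty => simp
  | insert i s hi ih =>
    rw [Finset.prod_insert hi, Finset.sum_insert hi, ih,
      ENNReal.rpow_add_of_nonneg _ _ (hf i) (Finset.sum_nonneg fun j _ => hf j)]

variable {ι : Type*} [Fintype ι] {Ψ : ℝ → ℝ≥0∞} {B : ℝ}

/-- Hölder with exponents `1 / a j ^ 2`: the factor `√(a j ^ 2)` in the hypothesis cancels the
Jacobian `1 / |a j|`, so no constant accumulates with the number of factors. Coordinates with `a j =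
0` drop out because `Ψ 0 = 1`. -/
lemma lintegral_prod_comp_mul_le (hΨ : Measurable Ψ) (hΨ0 : Ψ 0 = 1)
    (hB : ∀ r : ℝ, 0 < r → r ≤ 1 / 2 → ∫⁻ t, Ψ t ^ (1 / r) ≤ ENNReal.ofReal (B * √r))
    {a : ι → ℝ} (ha : ∑ j, a j ^ 2 = 1) (ha2 : ∀ j, a j ^ 2 ≤ 1 / 2) :
    ∫⁻ t, ∏ j, Ψ (a j * t) ≤ ENNReal.ofReal B := by
  calc ∫⁻ t, ∏ j, Ψ (a j * t)
      = ∫⁻ t, ∏ j, (Ψ (a j * t) ^ (1 / a j ^ 2 : ℝ)) ^ (a j ^ 2) := by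
        congr 1 with t
        refine Finset.prod_congr rfl fun j _ => ?_
        by_cases hj : a j = 0
        · simp [hj, hΨ0]
        · rw [← ENNReal.rpow_mul, one_div, inv_mul_cancel₀ (by positivity), ENNReal.rpow_one]
    _ ≤ ∏ j, (∫⁻ t, Ψ (a j * t) ^ (1 / a j ^ 2 : ℝ)) ^ (a j ^ 2) :=
        ENNReal.lintegral_prod_norm_pow_le _
          (fun j _ => ((hΨ.comp (measurable_const_mul _)).pow_const _).aemeasurable) ha
          fun j _ => sq_nonneg _
    _ ≤ ∏ j, (ENNReal.ofReal B) ^ (a j ^ 2) := by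
        refine Finset.prod_le_prod' fun j _ => ?_
        by_cases hj : a j = 0
        · simp [hj]
        · gcongr
          have hj' : 0 < |a j| := abs_pos.mpr hj
          rw [lintegral_comp_mul_left_real (f := fun t => Ψ t ^ (1 / a j ^ 2 : ℝ))
            (hΨ.pow_const _) hj]
          calc _ ≤ ENNReal.ofReal |(a j)⁻¹| * ENNReal.ofReal (B * √(a j ^ 2)) := by
                gcongr
                exact hB _ (by positivity) (ha2 j)
            _ = _ := by
                rw [← ENNReal.ofReal_mul (by positivity), Real.sqrt_sq_eq_abs, abs_inv]
                congr 1
                field_simp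
    _ = ENNReal.ofReal B := by
        rw [ENNReal.prod_rpow_eq_rpow_sum _ _ fun j => sq_nonneg _, ha, ENNReal.rpow_one]

section Plane

variable {a b : ι → ℝ}

lemma sum_cross_sq (ha : ∑ j, a j ^ 2 = 1) (hb : ∑ j, b j ^ 2 = 1) (hab : ∑ j, a j * b j = 0)
    (x y : ℝ) : ∑ k, (x * b k - y * a k) ^ 2 = x ^ 2 + y ^ 2 := by
  have : ∀ k, (x * b k - y * a k) ^ 2
      = x ^ 2 * b k ^ 2 + (-2 * x * y) * (a k * b k) + y ^ 2 * a k ^ 2 := fun k => by ring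
  simp_rw [this, Finset.sum_add_distrib, ← Finset.mul_sum]
  rw [ha, hb, hab]
  ring

lemma sqrt_le_exp_half {y : ℝ} (hy : 0 ≤ y) : √y ≤ Real.exp (y / 2) := by
  have h1 := Real.add_one_le_exp (y / 2)
  have h2 := Real.sq_sqrt hy
  nlinarith [sq_nonneg (√y - 1)]

/-- The contribution of one pair of linear forms to the Hölder bound in the plane. -/
lemma lintegral_pair_rpow_le (hΨ : Measurable Ψ) (hB0 : 0 ≤ B)
    (hB : ∀ r : ℝ, 0 < r → r ≤ 1 / 2 → ∫⁻ t, Ψ t ^ (1 / r) ≤ ENNReal.ofReal (B * √r))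
    {x y x' y' : ℝ} (h : x ^ 2 + y ^ 2 ≤ 1 / 2) (h' : x' ^ 2 + y' ^ 2 ≤ 1 / 2) :
    (∫⁻ θ : ℝ × ℝ, Ψ (x * θ.1 + y * θ.2) ^ (1 / (x ^ 2 + y ^ 2)) *
        Ψ (x' * θ.1 + y' * θ.2) ^ (1 / (x' ^ 2 + y' ^ 2))) ^ ((x * y' - y * x') ^ 2 / 2)
      ≤ ENNReal.ofReal (B ^ 2) ^ ((x * y' - y * x') ^ 2 / 2) *
        ENNReal.ofReal (Real.exp ((x ^ 2 + y ^ 2) * (x' ^ 2 + y' ^ 2) / 4)) := by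
  set r := x ^ 2 + y ^ 2 with hr
  set r' := x' ^ 2 + y' ^ 2 with hr'
  set D := x * y' - y * x' with hD
  have hr0 : 0 ≤ r := by positivity
  have hr0' : 0 ≤ r' := by positivity
  -- Proportional forms may have an infinite integral, but they carry the exponent `0`.
  by_cases hD0 : D = 0
  · simp only [hD0, ne_eq, OfNat.ofNat_ne_zero, not_false_eq_true, zero_pow, zero_div,
      ENNReal.rpow_zero, one_mul]
    rw [ENNReal.one_le_ofReal]
    exact Real.one_le_exp (by positivity)
  have hDabs : 0 < |D| := abs_pos.mpr hD0
  have hDsq : D ^ 2 ≤ r * r' := by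
    rw [hD, hr, hr']
    nlinarith [sq_nonneg (x * x' + y * y')]
  have hrr : 0 < r * r' := lt_of_lt_of_le (by positivity) hDsq
  have hrp : 0 < r := pos_of_mul_pos_left hrr hr0'
  have hrp' : 0 < r' := pos_of_mul_pos_right hrr hr0
  -- The change of variables leaves `√(r r' / D²)`, which blows up for nearly proportional forms.
  -- Bounding `√y` by `exp (y / 2)` makes the weight `D² / 2` cancel the denominator, leaving `exp
  -- (r r' / 4)`.
  have h1 : ∫⁻ θ : ℝ × ℝ, Ψ (x * θ.1 + y * θ.2) ^ (1 / r) * Ψ (x' * θ.1 + y' * θ.2) ^ (1 / r')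
      ≤ ENNReal.ofReal (B ^ 2) * ENNReal.ofReal (Real.exp (r * r' / D ^ 2 / 2)) := by
    rw [lintegral_mul_comp_linear_two (f := fun t => Ψ t ^ (1 / r)) (g := fun t => Ψ t ^ (1 / r'))
      (hΨ.pow_const _) (hΨ.pow_const _) hD0]
    calc _ ≤ ENNReal.ofReal |D⁻¹| * (ENNReal.ofReal (B * √r) * ENNReal.ofReal (B * √r')) := by
          gcongr
          · exact hB r hrp h
          · exact hB r' hrp' h'
      _ = ENNReal.ofReal (B ^ 2) * ENNReal.ofReal (√(r * r' / D ^ 2)) := by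
          rw [← ENNReal.ofReal_mul (by positivity), ← ENNReal.ofReal_mul (by positivity),
            ← ENNReal.ofReal_mul (by positivity), Real.sqrt_div hrr.le, Real.sqrt_mul hr0,
            Real.sqrt_sq_eq_abs, abs_inv]
          congr 1
          field_simp
      _ ≤ _ := by
          gcongr
          exact sqrt_le_exp_half (by positivity)
  calc _ ≤ (ENNReal.ofReal (B ^ 2) * ENNReal.ofReal (Real.exp (r * r' / D ^ 2 / 2))) ^ (D ^ 2 / 2) := by
        gcongr
    _ = _ := by
        rw [ENNReal.mul_rpow_of_nonneg _ _ (by positivity),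
          ENNReal.ofReal_rpow_of_nonneg (Real.exp_pos _).le (by positivity), ← Real.exp_mul]
        congr 3
        field_simp
        norm_num

/-- A Brascamp–Lieb type bound in the plane, with an absolute constant. -/
lemma lintegral_prod_comp_linear_le (hΨ : Measurable Ψ) (hΨ0 : Ψ 0 = 1) (hB0 : 0 ≤ B)
    (hB : ∀ r : ℝ, 0 < r → r ≤ 1 / 2 → ∫⁻ t, Ψ t ^ (1 / r) ≤ ENNReal.ofReal (B * √r))
    (ha : ∑ j, a j ^ 2 = 1) (hb : ∑ j, b j ^ 2 = 1) (hab : ∑ j, a j * b j = 0)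
    (hr : ∀ j, a j ^ 2 + b j ^ 2 ≤ 1 / 2) :
    ∫⁻ θ : ℝ × ℝ, ∏ j, Ψ (a j * θ.1 + b j * θ.2) ≤ ENNReal.ofReal (Real.exp 1 * B ^ 2) := by
  set r : ι → ℝ := fun j => a j ^ 2 + b j ^ 2 with hrdef
  set D : ι → ι → ℝ := fun j k => a j * b k - b j * a k with hDdef
  have hr0 (j) : 0 ≤ r j := by positivity
  have hDsum (j) : ∑ k, D j k ^ 2 = r j := sum_cross_sq ha hb hab _ _
  have hDsymm (j k) : D j k ^ 2 = D k j ^ 2 := by simp only [hDdef]; ring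
  have hrsum : ∑ j, r j = 2 := by
    simp only [hrdef, Finset.sum_add_distrib, ha, hb]; norm_num
  -- These weights sum to `1` by orthonormality. The `j`-th row and column each have sum `r j / 2`,
  -- so every form receives half of its exponent from each position in the pair.
  set w : ι × ι → ℝ := fun p => D p.1 p.2 ^ 2 / 2 with hw
  have hw0 (p) : 0 ≤ w p := by positivity
  have hwrow (j) : ∑ k, w (j, k) = r j / 2 := by
    simp only [hw, ← Finset.sum_div, hDsum]
  have hwcol (k) : ∑ j, w (j, k) = r k / 2 := by
    rw [← hwrow k]
    exact Finset.sum_congr rfl fun j _ => by simp only [hw, hDsymm j k]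
  have hwsum : ∑ p, w p = 1 := by
    rw [Fintype.sum_prod_type]
    simp only [hwrow, ← Finset.sum_div, hrsum]
    norm_num
  set L : ι → ℝ × ℝ → ℝ := fun j θ => a j * θ.1 + b j * θ.2 with hL
  have hLm (j) : Measurable (L j) := by fun_prop
  have hhalf (j) (θ) : (Ψ (L j θ) ^ (1 / r j)) ^ (r j / 2) = Ψ (L j θ) ^ (1 / 2 : ℝ) := by
    by_cases hj : r j = 0
    · have h1 : a j = 0 := by
        have : a j ^ 2 = 0 := le_antisymm (by have := sq_nonneg (b j); simp only [hrdef] at hj; linarith) (sq_nonneg _)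
        exact pow_eq_zero_iff (two_ne_zero) |>.mp this
      have h2 : b j = 0 := by
        have : b j ^ 2 = 0 := le_antisymm (by have := sq_nonneg (a j); simp only [hrdef] at hj; linarith) (sq_nonneg _)
        exact pow_eq_zero_iff (two_ne_zero) |>.mp this
      simp [hL, h1, h2, hΨ0]
    · rw [← ENNReal.rpow_mul]
      congr 1
      field_simp
  have hpt (θ : ℝ × ℝ) : ∏ j, Ψ (L j θ)
      = ∏ p : ι × ι, (Ψ (L p.1 θ) ^ (1 / r p.1) * Ψ (L p.2 θ) ^ (1 / r p.2)) ^ w p := by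
    simp_rw [ENNReal.mul_rpow_of_nonneg _ _ (hw0 _)]
    rw [Finset.prod_mul_distrib, Fintype.prod_prod_type, Fintype.prod_prod_type_right]
    simp only [ENNReal.prod_rpow_eq_rpow_sum _ _ fun _ => hw0 _, hwrow, hwcol, hhalf]
    rw [← Finset.prod_mul_distrib]
    refine Finset.prod_congr rfl fun j _ => ?_
    rw [← ENNReal.rpow_add_of_nonneg _ _ (by norm_num) (by norm_num)]
    norm_num
  calc ∫⁻ θ : ℝ × ℝ, ∏ j, Ψ (L j θ)
      = ∫⁻ θ : ℝ × ℝ, ∏ p : ι × ι,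
          (Ψ (L p.1 θ) ^ (1 / r p.1) * Ψ (L p.2 θ) ^ (1 / r p.2)) ^ w p := by
        simp_rw [hpt]
    _ ≤ ∏ p : ι × ι,
          (∫⁻ θ : ℝ × ℝ, Ψ (L p.1 θ) ^ (1 / r p.1) * Ψ (L p.2 θ) ^ (1 / r p.2)) ^ w p :=
        ENNReal.lintegral_prod_norm_pow_le _
          (fun p _ => (((hΨ.comp (hLm _)).pow_const _).mul
            ((hΨ.comp (hLm _)).pow_const _)).aemeasurable) hwsum fun p _ => hw0 p
    _ ≤ ∏ p : ι × ι, (ENNReal.ofReal (B ^ 2) ^ w p *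
          ENNReal.ofReal (Real.exp (r p.1 * r p.2 / 4))) :=
        Finset.prod_le_prod' fun p _ => lintegral_pair_rpow_le hΨ hB0 hB (hr _) (hr _)
    _ = ENNReal.ofReal (B ^ 2) * ENNReal.ofReal (Real.exp 1) := by
        rw [Finset.prod_mul_distrib, ENNReal.prod_rpow_eq_rpow_sum _ _ hw0, hwsum,
          ENNReal.rpow_one, ← ENNReal.ofReal_prod_of_nonneg fun p _ => (Real.exp_pos _).le,
          ← Real.exp_sum]
        -- The errors multiply to `exp ((∑ r j)² / 4) = e`, as `∑ r j = 2`.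
        congr 3
        rw [Fintype.sum_prod_type]
        simp only [← Finset.sum_div, ← Finset.mul_sum, hrsum, ← Finset.sum_mul]
        norm_num
    _ = _ := by rw [← ENNReal.ofReal_mul (by positivity), mul_comm]

end Plane

end Hoelder

/-! ### Esseen's inequality on the line and in the plane. -/

section SmallBall
open scoped ENNReal

variable {ι : Type*} [Fintype ι] {μ : Measure ℝ} [IsProbabilityMeasure μ]

lemma integral_pi_exp_linear (h : ι → ℝ) (c : ℝ) :
    ∫ g, Complex.exp ((∑ j, h j * g j + c : ℝ) * Complex.I) ∂(Measure.pi fun _ : ι => μ)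
      = Complex.exp (c * Complex.I) * ∏ j, charFun μ (h j) := by
  simp_rw [charFun_apply_real]
  rw [← integral_fintype_prod_eq_prod (μ := fun _ : ι => μ)
    (fun j (x : ℝ) => Complex.exp (h j * x * Complex.I)), ← integral_const_mul]
  congr 1 with g
  rw [← Complex.exp_sum, ← Complex.exp_add]
  congr 1
  push_cast
  rw [add_mul, Finset.sum_mul, add_comm]

/-- Esseen's smoothing bound: the smoothing kernel `F` is given as an average of characters. -/
lemma measure_pi_le_lintegral_charFun {Θ : Type*} [MeasurableSpace Θ] (γ : Measure Θ)
    [IsProbabilityMeasure γ] {h : Θ → ι → ℝ} (hh : ∀ j, Measurable fun θ => h θ j) {c : Θ → ℝ}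
    (hc : Measurable c) {F : (ι → ℝ) → ℝ} (hF : Continuous F) (hF0 : ∀ g, 0 ≤ F g)
    (hF1 : ∀ g, F g ≤ 1)
    (hFeq : ∀ g, (F g : ℂ) = ∫ θ, Complex.exp ((∑ j, h θ j * g j + c θ : ℝ) * Complex.I) ∂γ)
    {E : Set (ι → ℝ)} (hE : ∀ g ∈ E, Real.exp (-1) ≤ F g) :
    (Measure.pi fun _ : ι => μ) E
      ≤ ENNReal.ofReal (Real.exp 1) * ∫⁻ θ, ∏ j, ‖charFun μ (h θ j)‖ₑ ∂γ := by
  set ν : Measure (ι → ℝ) := Measure.pi fun _ : ι => μ with hν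
  have hFint : Integrable F ν := by
    refine Integrable.of_bound (C := 1) hF.aestronglyMeasurable (ae_of_all _ fun g => ?_)
    rw [Real.norm_eq_abs, abs_of_nonneg (hF0 g)]
    exact hF1 g
  have h1 : ENNReal.ofReal (Real.exp (-1)) * ν E ≤ ∫⁻ g, ENNReal.ofReal (F g) ∂ν := by
    refine le_trans ?_ (mul_meas_ge_le_lintegral hF.measurable.ennreal_ofReal
      (ENNReal.ofReal (Real.exp (-1))))
    gcongr
    exact fun g hg => ENNReal.ofReal_le_ofReal (hE g hg)
  have h2 : ∫⁻ g, ENNReal.ofReal (F g) ∂ν ≤ ∫⁻ θ, ∏ j, ‖charFun μ (h θ j)‖ₑ ∂γ := by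
    rw [← ofReal_integral_eq_lintegral_ofReal hFint (ae_of_all _ hF0)]
    have h3 : ENNReal.ofReal (∫ g, F g ∂ν) = ‖∫ g, (F g : ℂ) ∂ν‖ₑ := by
      rw [integral_complex_ofReal, ← ofReal_norm, Complex.norm_real, Real.norm_eq_abs,
        abs_of_nonneg (integral_nonneg hF0)]
    rw [h3]
    simp_rw [hFeq]
    rw [integral_integral_swap]
    · refine (enorm_integral_le_lintegral_enorm _).trans (le_of_eq ?_)
      congr 1 with θ
      rw [integral_pi_exp_linear, enorm_mul, ← ofReal_norm, Complex.norm_exp_ofReal_mul_I,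
        ENNReal.ofReal_one, one_mul]
      simp [enorm_eq_nnnorm, nnnorm_prod]
    · refine Integrable.of_bound (C := 1) ?_ (ae_of_all _ fun p => ?_)
      · unfold Function.uncurry
        exact (by fun_prop : Measurable _).aestronglyMeasurable
      · simp only [Function.uncurry]
        rw [Complex.norm_exp_ofReal_mul_I]
  calc ν E = ENNReal.ofReal (Real.exp 1) * (ENNReal.ofReal (Real.exp (-1)) * ν E) := by
        rw [← mul_assoc, ← ENNReal.ofReal_mul (by positivity), ← Real.exp_add]
        simp
    _ ≤ _ := by gcongr; exact h1.trans h2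

lemma gaussianReal_le_smul_volume {s : ℝ} (hs : 0 < s) :
    gaussianReal 0 (Real.toNNReal (1 / s ^ 2)) ≤ ENNReal.ofReal s • volume := by
  have hv : 0 < 1 / s ^ 2 := by positivity
  rw [gaussianReal_of_var_ne_zero _ (by rw [ne_eq, Real.toNNReal_eq_zero]; push Not; exact hv),
    ← withDensity_const]
  refine withDensity_mono (ae_of_all _ fun t => ?_)
  refine ENNReal.ofReal_le_ofReal ?_
  rw [gaussianPDFReal, Real.coe_toNNReal _ hv.le]
  have h1 : (√(2 * Real.pi * (1 / s ^ 2)))⁻¹ ≤ s := by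
    rw [Real.sqrt_mul (by positivity), Real.sqrt_div zero_le_one, Real.sqrt_one,
      Real.sqrt_sq hs.le, mul_inv, one_div, inv_inv]
    have : (√(2 * Real.pi))⁻¹ ≤ 1 := by
      refine inv_le_one_of_one_le₀ (Real.one_le_sqrt.mpr ?_)
      linarith [Real.pi_gt_three]
    nlinarith
  have h2 : Real.exp (-(t - 0) ^ 2 / (2 * (1 / s ^ 2))) ≤ 1 := by
    rw [Real.exp_le_one_iff, neg_div, neg_nonpos]
    positivity
  calc _ ≤ s * 1 := by gcongr
    _ = s := mul_one s

lemma integral_exp_gaussianReal {s : ℝ} (x : ℝ) :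
    ∫ θ : ℝ, Complex.exp ((θ * x : ℝ) * Complex.I) ∂(gaussianReal 0 (Real.toNNReal (1 / s ^ 2)))
      = (Real.exp (-(x ^ 2 / (2 * s ^ 2))) : ℂ) := by
  have h1 := charFun_gaussianReal (μ := 0) (v := Real.toNNReal (1 / s ^ 2)) x
  rw [charFun_apply_real] at h1
  have hv : 0 ≤ 1 / s ^ 2 := by positivity
  convert h1 using 1
  · congr 1 with θ
    push_cast
    ring_nf
  · rw [Real.coe_toNNReal _ hv, Complex.ofReal_exp]
    congr 1
    push_cast
    ring

/-- The kernel `exp (-x² / (2 s²))` is the average of characters over a Gaussian of variance `1 /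
s²`, whose density is at most `s`. -/
lemma measure_pi_abs_le_lintegral_charFun {s : ℝ} (hs : 0 < s) (a : ι → ℝ) (α : ℝ) :
    (Measure.pi fun _ : ι => μ) {g | |∑ j, a j * g j - α| ≤ s}
      ≤ ENNReal.ofReal (Real.exp 1 * s) * ∫⁻ t, ∏ j, ‖charFun μ (a j * t)‖ₑ := by
  refine (measure_pi_le_lintegral_charFun (gaussianReal 0 (Real.toNNReal (1 / s ^ 2)))
    (h := fun θ j => a j * θ) (c := fun θ => -α * θ)
    (F := fun g => Real.exp (-((∑ j, a j * g j - α) ^ 2 / (2 * s ^ 2))))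
    (by fun_prop) (by fun_prop) (by fun_prop) (fun g => (Real.exp_pos _).le)
    (fun g => ?_) (fun g => ?_) (fun g hg => ?_)).trans ?_
  · rw [Real.exp_le_one_iff, neg_nonpos]
    positivity
  · rw [← integral_exp_gaussianReal]
    congr 1 with θ
    congr 3
    rw [mul_sub, Finset.mul_sum, sub_eq_add_neg]
    congr 1
    · exact Finset.sum_congr rfl fun j _ => by ring
    · ring
  · rw [Real.exp_le_exp, neg_le_neg_iff, div_le_one (by positivity)]
    have h1 : (∑ j, a j * g j - α) ^ 2 ≤ s ^ 2 := sq_le_sq' (neg_le_of_abs_le hg) (le_of_abs_le hg)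
    nlinarith
  · rw [ENNReal.ofReal_mul (by positivity), mul_assoc]
    gcongr
    refine (lintegral_mono' (gaussianReal_le_smul_volume hs) le_rfl).trans ?_
    rw [lintegral_smul_measure, smul_eq_mul]

/-- The product of two such kernels is at least `exp (-1)` on the square, the threshold required in
Esseen's bound. -/
lemma measure_pi_abs_abs_le_lintegral_charFun {s : ℝ} (hs : 0 < s) (a b : ι → ℝ) (α β : ℝ) :
    (Measure.pi fun _ : ι => μ) {g | |∑ j, a j * g j - α| ≤ s ∧ |∑ j, b j * g j - β| ≤ s}
      ≤ ENNReal.ofReal (Real.exp 1 * s ^ 2) *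
        ∫⁻ θ : ℝ × ℝ, ∏ j, ‖charFun μ (a j * θ.1 + b j * θ.2)‖ₑ := by
  have hmc : Measurable (charFun μ) := measurable_charFun
  refine (measure_pi_le_lintegral_charFun ((gaussianReal 0 (Real.toNNReal (1 / s ^ 2))).prod
      (gaussianReal 0 (Real.toNNReal (1 / s ^ 2))))
    (h := fun θ j => a j * θ.1 + b j * θ.2) (c := fun θ => -α * θ.1 - β * θ.2)
    (F := fun g => Real.exp (-((∑ j, a j * g j - α) ^ 2 / (2 * s ^ 2))) *
      Real.exp (-((∑ j, b j * g j - β) ^ 2 / (2 * s ^ 2))))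
    (by fun_prop) (by fun_prop) (by fun_prop) (fun g => by positivity)
    (fun g => ?_) (fun g => ?_) (fun g hg => ?_)).trans ?_
  · rw [← Real.exp_add, Real.exp_le_one_iff, ← neg_add, neg_nonpos]
    positivity
  · rw [Complex.ofReal_mul, ← integral_exp_gaussianReal, ← integral_exp_gaussianReal,
      ← integral_prod_mul]
    congr 1 with θ
    rw [← Complex.exp_add, ← add_mul, ← Complex.ofReal_add]
    congr 3
    rw [mul_sub, mul_sub, Finset.mul_sum, Finset.mul_sum]
    simp only [add_mul, Finset.sum_add_distrib]
    have h1 (x : ℝ) (a : ι → ℝ) : ∑ j, x * (a j * g j) = ∑ j, a j * x * g j :=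
      Finset.sum_congr rfl fun j _ => by ring
    rw [h1, h1]
    ring
  · have h1 : (∑ j, a j * g j - α) ^ 2 ≤ s ^ 2 :=
      sq_le_sq' (neg_le_of_abs_le hg.1) (le_of_abs_le hg.1)
    have h2 : (∑ j, b j * g j - β) ^ 2 ≤ s ^ 2 :=
      sq_le_sq' (neg_le_of_abs_le hg.2) (le_of_abs_le hg.2)
    rw [← Real.exp_add, Real.exp_le_exp, ← neg_add, neg_le_neg_iff, ← add_div,
      div_le_one (by positivity)]
    linarith
  · rw [ENNReal.ofReal_mul (by positivity), mul_assoc]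
    gcongr
    have hm : Measurable fun θ : ℝ × ℝ => ∏ j, ‖charFun μ (a j * θ.1 + b j * θ.2)‖ₑ :=
      Finset.measurable_prod _ fun j _ => (hmc.comp (by fun_prop)).enorm
    rw [lintegral_prod _ hm.aemeasurable, Measure.volume_eq_prod, lintegral_prod _ hm.aemeasurable]
    refine (lintegral_mono' (gaussianReal_le_smul_volume hs) fun x =>
      lintegral_mono' (gaussianReal_le_smul_volume hs) le_rfl).trans ?_
    simp only [lintegral_smul_measure, smul_eq_mul]
    rw [lintegral_const_mul' _ _ ENNReal.ofReal_ne_top, ← mul_assoc,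
      ← ENNReal.ofReal_mul hs.le, sq]

end SmallBall

/-! ### Dimension-free small ball estimates for one and two linear forms. -/

section SmallBallBounds
open scoped ENNReal

/-- The set of `y` with `|x y + c| ≤ s` has small measure under a law with bounded density. -/
lemma measure_abs_mul_add_le {μ : Measure ℝ} {K : ℝ} (hK : 0 ≤ K)
    (hμ : μ ≤ ENNReal.ofReal K • volume) {x : ℝ} (hx : x ≠ 0) (c s : ℝ) :
    μ {y | |x * y + c| ≤ s} ≤ ENNReal.ofReal (2 * K * s / |x|) := by
  have hx' : 0 < |x| := abs_pos.mpr hx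
  calc μ {y | |x * y + c| ≤ s} ≤ (ENNReal.ofReal K • volume) {y | |x * y + c| ≤ s} := hμ _
    _ ≤ (ENNReal.ofReal K • volume) (Set.Icc (-c / x - s / |x|) (-c / x + s / |x|)) := by
        refine measure_mono fun y hy => ?_
        have h1 : |y - -c / x| ≤ s / |x| := by
          rw [le_div_iff₀ hx', ← abs_mul]
          have : (y - -c / x) * x = x * y + c := by field_simp; ring
          rw [this]
          exact hy
        have h2 := abs_le.mp h1
        constructor <;> linarith [h2.1, h2.2]
    _ = _ := by
        rw [Measure.smul_apply, Real.volume_Icc, smul_eq_mul, ← ENNReal.ofReal_mul hK]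
        congr 1
        ring

variable {ι : Type*} [Fintype ι]

/-- The event `A` ignores coordinate `j`, so integrating that coordinate first gains the
one-variable factor at every point of `A`. -/
lemma measure_pi_inter_abs_le {μ : Measure ℝ} [IsProbabilityMeasure μ] {K : ℝ} (hK : 0 ≤ K)
    (hμ : μ ≤ ENNReal.ofReal K • volume) [DecidableEq ι] {a : ι → ℝ} {j : ι} (hj : a j ≠ 0)
    (α s : ℝ) {A : Set (ι → ℝ)} (hA : MeasurableSet A)
    (hAj : ∀ g y, Function.update g j y ∈ A ↔ g ∈ A) :
    (Measure.pi fun _ : ι => μ) (A ∩ {g | |∑ k, a k * g k - α| ≤ s})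
      ≤ ENNReal.ofReal (2 * K * s / |a j|) * (Measure.pi fun _ : ι => μ) A := by
  have hS : MeasurableSet {g : ι → ℝ | |∑ k, a k * g k - α| ≤ s} :=
    measurableSet_le (by fun_prop) measurable_const
  rw [← lintegral_indicator_one (hA.inter hS), ← lintegral_indicator_one hA,
    ← lintegral_const_mul _ (measurable_one.indicator hA)]
  refine lintegral_le_of_lmarginal_le {j} (measurable_one.indicator (hA.inter hS))
    ((measurable_one.indicator hA).const_mul _) fun g => ?_
  rw [lmarginal_singleton, lmarginal_singleton]
  by_cases hg : g ∈ A
  · have h1 (y : ℝ) : A.indicator (1 : (ι → ℝ) → ℝ≥0∞) (Function.update g j y) = 1 := by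
      rw [Set.indicator_of_mem ((hAj g y).mpr hg), Pi.one_apply]
    simp only [h1, mul_one, lintegral_const, measure_univ]
    set c := ∑ k ∈ Finset.univ.erase j, a k * g k - α with hc
    have hsum (y : ℝ) : ∑ k, a k * Function.update g j y k - α = a j * y + c := by
      rw [← Finset.add_sum_erase _ _ (Finset.mem_univ j), Function.update_self, hc, add_sub_assoc]
      congr 2
      exact Finset.sum_congr rfl fun k hk => by
        rw [Function.update_of_ne (Finset.ne_of_mem_erase hk)]
    refine le_trans ?_ (measure_abs_mul_add_le hK hμ hj c s)
    have hT : MeasurableSet {y : ℝ | |a j * y + c| ≤ s} :=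
      measurableSet_le (by fun_prop) measurable_const
    rw [← lintegral_indicator_one hT]
    refine lintegral_mono fun y => ?_
    by_cases hy : Function.update g j y ∈ A ∩ {g | |∑ k, a k * g k - α| ≤ s}
    · have hy' : y ∈ {y : ℝ | |a j * y + c| ≤ s} := by
        have := hy.2
        rwa [Set.mem_ofPred_eq, hsum] at this
      rw [Set.indicator_of_mem hy, Set.indicator_of_mem hy', Pi.one_apply, Pi.one_apply]
    · rw [Set.indicator_of_notMem hy]
      exact zero_le
  · have h1 (y : ℝ) : (A ∩ {g | |∑ k, a k * g k - α| ≤ s}).indicator (1 : (ι → ℝ) → ℝ≥0∞)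
        (Function.update g j y) = 0 :=
      Set.indicator_of_notMem (fun h => hg ((hAj g y).mp h.1)) _
    simp [h1]

/-- The linear small ball bound: an `ℓ²`-normalized linear form in independent variables of
density at most `K` has concentration function `O(K s)`. -/
lemma exists_measure_pi_abs_le : ∃ C : ℝ, 0 < C ∧
    ∀ (ι : Type) [Fintype ι] (μ : Measure ℝ) [IsProbabilityMeasure μ] (K : ℝ), 0 ≤ K →
      μ ≤ ENNReal.ofReal K • volume → ∀ (a : ι → ℝ) (α s : ℝ), 0 < s → ∑ j, a j ^ 2 = 1 →
        (Measure.pi fun _ : ι => μ) {g | |∑ j, a j * g j - α| ≤ s} ≤ ENNReal.ofReal (C * K * s) := by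
  classical
  obtain ⟨C, hC, hCb⟩ := exists_lintegral_enorm_charFun_rpow_le
  refine ⟨4 + Real.exp 1 * C, by positivity, ?_⟩
  intro ι _ μ _ K hK hμ a α s hs ha
  -- A coordinate with `a j ^ 2 > 1/2` would need a Hölder exponent below `2`; its own density
  -- suffices instead.
  by_cases hbig : ∃ j, 1 / 2 < a j ^ 2
  · obtain ⟨j, hj⟩ := hbig
    have hj0 : a j ≠ 0 := by
      intro h
      rw [h] at hj
      norm_num at hj
    have hj2 : 1 / 2 < |a j| := by
      rw [← sq_abs] at hj
      nlinarith [abs_nonneg (a j)]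
    have h1 := measure_pi_inter_abs_le hK hμ hj0 α s MeasurableSet.univ (by simp)
    rw [Set.univ_inter, measure_univ, mul_one] at h1
    refine h1.trans (ENNReal.ofReal_le_ofReal ?_)
    rw [div_le_iff₀ (by linarith)]
    have h2 : 0 ≤ K * s := by positivity
    have h3 : 0 ≤ Real.exp 1 * C * (K * s) * |a j| := by positivity
    nlinarith
  · push Not at hbig
    refine (measure_pi_abs_le_lintegral_charFun hs a α).trans ?_
    have hmc : Measurable (charFun μ) := measurable_charFun
    have h1 := lintegral_prod_comp_mul_le (Ψ := fun t => ‖charFun μ t‖ₑ) hmc.enorm (by simp)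
      (hCb μ K hK hμ) ha hbig
    calc _ ≤ ENNReal.ofReal (Real.exp 1 * s) * ENNReal.ofReal (C * K) := by gcongr
      _ ≤ _ := by
        rw [← ENNReal.ofReal_mul (by positivity)]
        refine ENNReal.ofReal_le_ofReal ?_
        have h2 : 0 ≤ K * s := by positivity
        nlinarith

/-- The planar bound when one coordinate carries a fixed proportion of the first form. -/
lemma measure_pi_square_le_of_large {C : ℝ}
    (hCb : ∀ (ι : Type) [Fintype ι] (μ : Measure ℝ) [IsProbabilityMeasure μ] (K : ℝ), 0 ≤ K →
      μ ≤ ENNReal.ofReal K • volume → ∀ (a : ι → ℝ) (α s : ℝ), 0 < s → ∑ j, a j ^ 2 = 1 →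
        (Measure.pi fun _ : ι => μ) {g | |∑ j, a j * g j - α| ≤ s} ≤ ENNReal.ofReal (C * K * s))
    {ι : Type} [Fintype ι] {μ : Measure ℝ} [IsProbabilityMeasure μ] {K : ℝ} (hK : 0 ≤ K)
    (hμ : μ ≤ ENNReal.ofReal K • volume) {a b : ι → ℝ} (α β : ℝ) {s : ℝ} (hs : 0 < s)
    (ha : ∑ j, a j ^ 2 = 1) (hb : ∑ j, b j ^ 2 = 1) (hab : ∑ j, a j * b j = 0) {j : ι}
    (hj : 1 / 4 < a j ^ 2) :
    (Measure.pi fun _ : ι => μ) {g | |∑ j, a j * g j - α| ≤ s ∧ |∑ j, b j * g j - β| ≤ s}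
      ≤ ENNReal.ofReal (16 * C * K ^ 2 * s ^ 2) := by
  classical
  have hj0 : a j ≠ 0 := by
    intro h
    rw [h] at hj
    norm_num at hj
  have hjabs : 1 / 2 < |a j| := by
    rw [← sq_abs] at hj
    nlinarith [abs_nonneg (a j)]
  have haj1 : |a j| ≤ 1 := by
    rw [← sq_le_one_iff_abs_le_one, ← ha]
    exact Finset.single_le_sum (f := fun j => a j ^ 2) (fun k _ => sq_nonneg _) (Finset.mem_univ j)
  have hbj1 : |b j| ≤ 1 := by
    rw [← sq_le_one_iff_abs_le_one, ← hb]
    exact Finset.single_le_sum (f := fun j => b j ^ 2) (fun k _ => sq_nonneg _) (Finset.mem_univ j)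
  set ρ : ℝ := √(a j ^ 2 + b j ^ 2) with hρ
  have hρsq : ρ ^ 2 = a j ^ 2 + b j ^ 2 := Real.sq_sqrt (by positivity)
  have hρhalf : 1 / 2 ≤ ρ := by
    refine Real.le_sqrt_of_sq_le ?_
    nlinarith [sq_nonneg (b j)]
  -- This normalized combination of the two forms does not involve coordinate `j`. It is controlled
  -- within `2 s / ρ ≤ 4 s` on the event, so its bound and that from coordinate `j` multiply.
  set d : ι → ℝ := fun k => (a j * b k - b j * a k) / ρ with hd
  have hdsum : ∑ k, d k ^ 2 = 1 := by
    simp only [hd, div_pow, ← Finset.sum_div]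
    rw [sum_cross_sq ha hb hab, ← hρsq, div_self (by positivity)]
  have hdj : d j = 0 := by simp only [hd]; ring
  set δ : ℝ := (a j * β - b j * α) / ρ with hδ
  set A : Set (ι → ℝ) := {g | |∑ k, d k * g k - δ| ≤ 4 * s} with hA
  have hAm : MeasurableSet A := measurableSet_le (by fun_prop) measurable_const
  have hAj (g : ι → ℝ) (y : ℝ) : Function.update g j y ∈ A ↔ g ∈ A := by
    have : ∑ k, d k * Function.update g j y k = ∑ k, d k * g k := by
      refine Finset.sum_congr rfl fun k _ => ?_
      by_cases hk : k = j
      · rw [hk, hdj, zero_mul, zero_mul]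
      · rw [Function.update_of_ne hk]
    simp only [hA, Set.mem_ofPred_eq, this]
  have hsub : {g : ι → ℝ | |∑ j, a j * g j - α| ≤ s ∧ |∑ j, b j * g j - β| ≤ s}
      ⊆ A ∩ {g | |∑ j, a j * g j - α| ≤ s} := by
    intro g hg
    refine ⟨?_, hg.1⟩
    have h1 : ∑ k, d k * g k - δ
        = (a j * (∑ k, b k * g k - β) - b j * (∑ k, a k * g k - α)) / ρ := by
      have h2 : ∑ k, d k * g k = (a j * ∑ k, b k * g k - b j * ∑ k, a k * g k) / ρ := by
        rw [Finset.mul_sum, Finset.mul_sum, ← Finset.sum_sub_distrib, Finset.sum_div]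
        exact Finset.sum_congr rfl fun k _ => by simp only [hd]; ring
      rw [h2, hδ]
      ring
    simp only [hA, Set.mem_ofPred_eq]
    rw [h1, abs_div, abs_of_pos (by linarith : 0 < ρ), div_le_iff₀ (by linarith)]
    calc _ ≤ |a j * (∑ k, b k * g k - β)| + |b j * (∑ k, a k * g k - α)| := abs_sub _ _
      _ ≤ 1 * s + 1 * s := by
        rw [abs_mul, abs_mul]
        gcongr
        · exact hg.2
        · exact hg.1
      _ ≤ _ := by nlinarith
  calc _ ≤ _ := measure_mono hsub
    _ ≤ _ := measure_pi_inter_abs_le hK hμ hj0 α s hAm hAj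
    _ ≤ ENNReal.ofReal (4 * K * s) * ENNReal.ofReal (C * K * (4 * s)) := by
        gcongr
        · rw [div_le_iff₀ (by linarith)]
          have : 0 ≤ K * s := by positivity
          nlinarith
        · exact hCb ι μ K hK hμ d δ (4 * s) (by linarith) hdsum
    _ = _ := by
        rw [← ENNReal.ofReal_mul (by positivity)]
        congr 1
        ring

/-- If some `a j ^ 2 + b j ^ 2` exceeds `1/2`, one of the two forms has a coordinate of square above
`1/4`, and that coordinate is removed by hand. Otherwise the Hölder bound in the plane applies. -/
lemma exists_measure_pi_square_le : ∃ C : ℝ, 0 < C ∧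
    ∀ (ι : Type) [Fintype ι] (μ : Measure ℝ) [IsProbabilityMeasure μ] (K : ℝ), 0 ≤ K →
      μ ≤ ENNReal.ofReal K • volume → ∀ (a b : ι → ℝ) (α β s : ℝ), 0 < s → ∑ j, a j ^ 2 = 1 →
      ∑ j, b j ^ 2 = 1 → ∑ j, a j * b j = 0 →
        (Measure.pi fun _ : ι => μ) {g | |∑ j, a j * g j - α| ≤ s ∧ |∑ j, b j * g j - β| ≤ s}
          ≤ ENNReal.ofReal (C * K ^ 2 * s ^ 2) := by
  obtain ⟨C, hC, hCb⟩ := exists_lintegral_enorm_charFun_rpow_le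
  obtain ⟨C₁, hC₁, hC₁b⟩ := exists_measure_pi_abs_le
  refine ⟨16 * C₁ + Real.exp 1 * (Real.exp 1 * C ^ 2), by positivity, ?_⟩
  intro ι _ μ _ K hK hμ a b α β s hs ha hb hab
  have hle₁ : 16 * C₁ * K ^ 2 * s ^ 2
      ≤ (16 * C₁ + Real.exp 1 * (Real.exp 1 * C ^ 2)) * K ^ 2 * s ^ 2 := by
    have : 0 ≤ Real.exp 1 * (Real.exp 1 * C ^ 2) * K ^ 2 * s ^ 2 := by positivity
    linarith
  have hle₂ : Real.exp 1 * s ^ 2 * (Real.exp 1 * (C * K) ^ 2)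
      ≤ (16 * C₁ + Real.exp 1 * (Real.exp 1 * C ^ 2)) * K ^ 2 * s ^ 2 := by
    have : 0 ≤ 16 * C₁ * K ^ 2 * s ^ 2 := by positivity
    linarith
  by_cases hbig : ∃ j, 1 / 2 < a j ^ 2 + b j ^ 2
  · obtain ⟨j, hj⟩ := hbig
    refine le_trans ?_ (ENNReal.ofReal_le_ofReal hle₁)
    rcases lt_or_ge (1 / 4) (a j ^ 2) with h | h
    · exact measure_pi_square_le_of_large hC₁b hK hμ α β hs ha hb hab h
    · have h1 := measure_pi_square_le_of_large hC₁b hK hμ β α hs hb ha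
        (by simpa only [mul_comm] using hab) (j := j) (by linarith)
      simpa only [and_comm] using h1
  · push Not at hbig
    refine le_trans ?_ (ENNReal.ofReal_le_ofReal hle₂)
    refine (measure_pi_abs_abs_le_lintegral_charFun hs a b α β).trans ?_
    have hmc : Measurable (charFun μ) := measurable_charFun
    have h1 := lintegral_prod_comp_linear_le (Ψ := fun t => ‖charFun μ t‖ₑ) hmc.enorm (by simp)
      (by positivity) (hCb μ K hK hμ) ha hb hab hbig
    rw [ENNReal.ofReal_mul (p := Real.exp 1 * s ^ 2) (by positivity)]
    gcongr

lemma exists_measure_pi_rectangle_le : ∃ C : ℝ, 0 < C ∧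
    ∀ (ι : Type) [Fintype ι] (μ : Measure ℝ) [IsProbabilityMeasure μ] (K : ℝ), 0 ≤ K →
      μ ≤ ENNReal.ofReal K • volume → ∀ (a b : ι → ℝ) (α β s s' : ℝ), 0 < s → s ≤ s' →
      ∑ j, a j ^ 2 = 1 → ∑ j, b j ^ 2 = 1 → ∑ j, a j * b j = 0 →
        (Measure.pi fun _ : ι => μ) {g | |∑ j, a j * g j - α| ≤ s ∧ |∑ j, b j * g j - β| ≤ s'}
          ≤ ENNReal.ofReal (C * K ^ 2 * (s * s')) := by
  obtain ⟨C, hC, hCb⟩ := exists_measure_pi_square_le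
  refine ⟨2 * C, by positivity, ?_⟩
  intro ι _ μ _ K hK hμ a b α β s s' hs hss ha hb hab
  have hs' : 0 < s' := hs.trans_le hss
  -- The rectangle is covered by `N ≤ 2 s' / s` squares of half-side `s`, stacked along the second
  -- form.
  set N : ℕ := ⌊s' / s⌋₊ + 1 with hN
  have hNle : (N : ℝ) ≤ 2 * (s' / s) := by
    have h1 : (⌊s' / s⌋₊ : ℝ) ≤ s' / s := Nat.floor_le (by positivity)
    have h2 : 1 ≤ s' / s := by rwa [le_div_iff₀ hs, one_mul]
    rw [hN]
    push_cast
    linarith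
  have hsub : {g : ι → ℝ | |∑ j, a j * g j - α| ≤ s ∧ |∑ j, b j * g j - β| ≤ s'} ⊆
      ⋃ m ∈ Finset.range N, {g | |∑ j, a j * g j - α| ≤ s ∧
        |∑ j, b j * g j - (β - s' + (2 * m + 1) * s)| ≤ s} := by
    intro g hg
    obtain ⟨h1, h2⟩ := hg
    set y := ∑ j, b j * g j - β with hy
    have hy2 := abs_le.mp h2
    set m : ℕ := ⌊(y + s') / (2 * s)⌋₊ with hm
    have hm0 : 0 ≤ (y + s') / (2 * s) := div_nonneg (by linarith) (by linarith)
    have hm1 : (m : ℝ) ≤ (y + s') / (2 * s) := Nat.floor_le hm0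
    have hm2 : (y + s') / (2 * s) < m + 1 := Nat.lt_floor_add_one _
    simp only [Set.mem_iUnion, Finset.mem_range]
    refine ⟨m, ?_, h1, ?_⟩
    · rw [hN, Nat.lt_succ_iff]
      refine Nat.floor_le_floor ?_
      rw [div_le_div_iff₀ (by linarith) hs]
      nlinarith
    · rw [le_div_iff₀ (by linarith)] at hm1
      rw [div_lt_iff₀ (by linarith)] at hm2
      rw [abs_le]
      constructor <;> linarith
  calc _ ≤ _ := measure_mono hsub
    _ ≤ ∑ m ∈ Finset.range N, (Measure.pi fun _ : ι => μ) {g | |∑ j, a j * g j - α| ≤ s ∧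
        |∑ j, b j * g j - (β - s' + (2 * m + 1) * s)| ≤ s} := measure_biUnion_finset_le _ _
    _ ≤ ∑ m ∈ Finset.range N, ENNReal.ofReal (C * K ^ 2 * s ^ 2) :=
        Finset.sum_le_sum fun m _ => hCb ι μ K hK hμ a b α _ s hs ha hb hab
    _ = ENNReal.ofReal (N * (C * K ^ 2 * s ^ 2)) := by
        rw [Finset.sum_const, Finset.card_range, nsmul_eq_mul,
          ENNReal.ofReal_mul (p := (N : ℝ)) (by positivity),
          ENNReal.ofReal_natCast]
    _ ≤ _ := by
        refine ENNReal.ofReal_le_ofReal ?_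
        calc (N : ℝ) * (C * K ^ 2 * s ^ 2) ≤ 2 * (s' / s) * (C * K ^ 2 * s ^ 2) := by gcongr
          _ = _ := by field_simp

/-- The linear small ball bound for a form of arbitrary `ℓ²` norm `A`. -/
lemma exists_measure_pi_abs_le_div : ∃ C : ℝ, 0 < C ∧
    ∀ (ι : Type) [Fintype ι] (μ : Measure ℝ) [IsProbabilityMeasure μ] (K : ℝ), 0 ≤ K →
      μ ≤ ENNReal.ofReal K • volume → ∀ (a : ι → ℝ) (α s A : ℝ), 0 < s → 0 < A →
      ∑ j, a j ^ 2 = A ^ 2 →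
        (Measure.pi fun _ : ι => μ) {g | |∑ j, a j * g j - α| ≤ s}
          ≤ ENNReal.ofReal (C * K * (s / A)) := by
  obtain ⟨C, hC, hCb⟩ := exists_measure_pi_abs_le
  refine ⟨C, hC, ?_⟩
  intro ι _ μ _ K hK hμ a α s A hs hA ha
  have h1 := hCb ι μ K hK hμ (fun j => a j / A) (α / A) (s / A) (by positivity)
    (by simp only [div_pow, ← Finset.sum_div]; rw [ha, div_self (by positivity)])
  refine le_trans (measure_mono fun g hg => ?_) h1
  simp only [Set.mem_ofPred_eq, div_mul_eq_mul_div, ← Finset.sum_div, ← sub_div, abs_div,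
    abs_of_pos hA] at hg ⊢
  gcongr

/-- The planar small ball bound for two orthogonal forms of norms `A ≥ B`. -/
lemma exists_measure_pi_rectangle_le_div : ∃ C : ℝ, 0 < C ∧
    ∀ (ι : Type) [Fintype ι] (μ : Measure ℝ) [IsProbabilityMeasure μ] (K : ℝ), 0 ≤ K →
      μ ≤ ENNReal.ofReal K • volume → ∀ (a b : ι → ℝ) (α β s A B : ℝ), 0 < s → 0 < B → B ≤ A →
      ∑ j, a j ^ 2 = A ^ 2 → ∑ j, b j ^ 2 = B ^ 2 → ∑ j, a j * b j = 0 →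
        (Measure.pi fun _ : ι => μ) {g | |∑ j, a j * g j - α| ≤ s ∧ |∑ j, b j * g j - β| ≤ s}
          ≤ ENNReal.ofReal (C * K ^ 2 * (s / A * (s / B))) := by
  obtain ⟨C, hC, hCb⟩ := exists_measure_pi_rectangle_le
  refine ⟨C, hC, ?_⟩
  intro ι _ μ _ K hK hμ a b α β s A B hs hB hBA ha hb hab
  have hA : 0 < A := hB.trans_le hBA
  have h1 := hCb ι μ K hK hμ (fun j => a j / A) (fun j => b j / B) (α / A) (β / B) (s / A) (s / B)
    (by positivity) (by gcongr)
    (by simp only [div_pow, ← Finset.sum_div]; rw [ha, div_self (by positivity)])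
    (by simp only [div_pow, ← Finset.sum_div]; rw [hb, div_self (by positivity)])
    (by simp only [div_mul_div_comm, ← Finset.sum_div]; rw [hab, zero_div])
  refine le_trans (measure_mono fun g hg => ?_) h1
  simp only [Set.mem_ofPred_eq, div_mul_eq_mul_div, ← Finset.sum_div, ← sub_div, abs_div,
    abs_of_pos hA, abs_of_pos hB] at hg ⊢
  exact ⟨by gcongr; exact hg.1, by gcongr; exact hg.2⟩

end SmallBallBounds

/-! ### Vectors annihilating all columns but one. -/

section Annihilator

lemma exists_norm_one_sq_mul_eq_norm (s : ℂ) : ∃ ω : ℂ, ‖ω‖ = 1 ∧ ω ^ 2 * s = (‖s‖ : ℂ) := by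
  refine ⟨Complex.exp ((-(s.arg / 2) : ℝ) * Complex.I), Complex.norm_exp_ofReal_mul_I _, ?_⟩
  nth_rewrite 2 [← Complex.norm_mul_exp_arg_mul_I s]
  rw [mul_left_comm, ← Complex.exp_nat_mul, ← Complex.exp_add]
  have : ((2 : ℕ) : ℂ) * ((-(s.arg / 2) : ℝ) * Complex.I) + s.arg * Complex.I = 0 := by
    push_cast
    ring
  rw [this, Complex.exp_zero, mul_one]

variable {n : ℕ}

/-- A unit vector annihilating all columns but one, with orthogonal real and imaginary parts, the
real part being the longer one. -/
lemma exists_annihilator (M : Matrix (Fin n) (Fin n) ℂ) (i : Fin n) : ∃ u : Fin n → ℂ,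
    ∑ j, (u j).re ^ 2 + ∑ j, (u j).im ^ 2 = 1 ∧ ∑ j, (u j).im ^ 2 ≤ ∑ j, (u j).re ^ 2 ∧
    ∑ j, (u j).re * (u j).im = 0 ∧ ∀ k, k ≠ i → ∑ j, u j * M j k = 0 := by
  -- Zeroing column `i` makes the matrix singular, hence a left null vector exists.
  have hdet : (M.updateCol i 0).det = 0 :=
    Matrix.det_eq_zero_of_column_eq_zero i fun j => by simp
  obtain ⟨w, hw0, hw⟩ := Matrix.exists_vecMul_eq_zero_iff.mpr hdet
  have hwk (k) (hk : k ≠ i) : ∑ j, w j * M j k = 0 := by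
    have := congrFun hw k
    simpa [Matrix.vecMul, dotProduct, Matrix.updateCol_ne hk] using this
  set N : ℝ := ∑ j, ‖w j‖ ^ 2 with hN
  have hNpos : 0 < N := by
    obtain ⟨j, hj⟩ := Function.ne_iff.mp hw0
    refine Finset.sum_pos' (fun k _ => by positivity) ⟨j, Finset.mem_univ j, ?_⟩
    have : 0 < ‖w j‖ := norm_pos_iff.mpr hj
    positivity
  -- The phase makes `∑ (u j)²` a nonnegative real. Its imaginary part is twice the inner product of
  -- the real and imaginary parts of `u`, and its real part is the difference of their squared
  -- norms.
  obtain ⟨ω, hω1, hω⟩ := exists_norm_one_sq_mul_eq_norm (∑ j, w j ^ 2)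
  set c : ℂ := ω / (√N : ℝ) with hc
  have hcnorm : ‖c‖ ^ 2 = 1 / N := by
    rw [hc, norm_div, hω1, Complex.norm_real, div_pow, Real.norm_eq_abs, sq_abs,
      Real.sq_sqrt hNpos.le, one_pow]
  have hsq : ∑ j, (c * w j) ^ 2 = ((‖∑ j, w j ^ 2‖ / N : ℝ) : ℂ) := by
    simp only [mul_pow, ← Finset.mul_sum]
    rw [hc, div_pow, div_mul_eq_mul_div, hω, ← Complex.ofReal_pow, Real.sq_sqrt hNpos.le]
    push_cast
    rfl
  have hre := congrArg Complex.re hsq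
  have him := congrArg Complex.im hsq
  rw [Complex.re_sum, Complex.ofReal_re] at hre
  rw [Complex.im_sum, Complex.ofReal_im] at him
  refine ⟨fun j => c * w j, ?_, ?_, ?_, fun k hk => ?_⟩
  · have h1 (j) : (c * w j).re ^ 2 + (c * w j).im ^ 2 = ‖w j‖ ^ 2 / N := by
      have h2 : ‖c * w j‖ ^ 2 = (c * w j).re ^ 2 + (c * w j).im ^ 2 := by
        rw [Complex.sq_norm, Complex.normSq_apply]; ring
      rw [← h2, norm_mul, mul_pow, hcnorm]; ring
    rw [← Finset.sum_add_distrib]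
    simp only [h1, ← Finset.sum_div]
    exact div_self hNpos.ne'
  · have h1 : ∑ j, ((c * w j) ^ 2).re = ∑ j, (c * w j).re ^ 2 - ∑ j, (c * w j).im ^ 2 := by
      rw [← Finset.sum_sub_distrib]
      exact Finset.sum_congr rfl fun j _ => by rw [sq, Complex.mul_re]; ring
    have h2 : 0 ≤ ‖∑ j, w j ^ 2‖ / N := by positivity
    linarith
  · have h1 : ∑ j, ((c * w j) ^ 2).im = 2 * ∑ j, (c * w j).re * (c * w j).im := by
      rw [Finset.mul_sum]
      exact Finset.sum_congr rfl fun j _ => by rw [sq, Complex.mul_im]; ring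
    linarith
  · simp only [mul_assoc, ← Finset.mul_sum, hwk k hk, mul_zero]

/-- If `M v` is small and the `i`-th entry of `v` is not, then the `i`-th column of `M` is nearly
annihilated by every vector that annihilates the others. -/
lemma norm_sum_mul_col_le {M : Matrix (Fin n) (Fin n) ℂ} {i : Fin n} {u v : Fin n → ℂ} {ε : ℝ}
    (hε : 0 ≤ ε) (hu : ∑ j, ‖u j‖ ^ 2 = 1) (huM : ∀ k, k ≠ i → ∑ j, u j * M j k = 0)
    (hvi : 1 ≤ n * ‖v i‖ ^ 2) (hMv : ∑ j, ‖(M.mulVec v) j‖ ^ 2 ≤ ε ^ 2) :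
    ‖∑ j, u j * M j i‖ ≤ ε * √n := by
  have h1 : ∑ j, u j * (M.mulVec v) j = (∑ j, u j * M j i) * v i := by
    have : ∑ j, u j * (M.mulVec v) j = ∑ k, (∑ j, u j * M j k) * v k := by
      simp only [Matrix.mulVec, dotProduct, Finset.mul_sum, Finset.sum_mul]
      rw [Finset.sum_comm]
      exact Finset.sum_congr rfl fun k _ => Finset.sum_congr rfl fun j _ => by ring
    rw [this, Finset.sum_eq_single i]
    · intro k _ hk
      rw [huM k hk, zero_mul]
    · simp
  have h2 : ‖∑ j, u j * (M.mulVec v) j‖ ≤ ε := by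
    have h3 : ‖∑ j, u j * (M.mulVec v) j‖ ≤ ∑ j, ‖u j‖ * ‖(M.mulVec v) j‖ :=
      (norm_sum_le _ _).trans (le_of_eq (Finset.sum_congr rfl fun j _ => norm_mul _ _))
    have h4 := Finset.sum_mul_sq_le_sq_mul_sq Finset.univ (fun j => ‖u j‖)
      (fun j => ‖(M.mulVec v) j‖)
    rw [hu, one_mul] at h4
    exact h3.trans (abs_le_of_sq_le_sq' (h4.trans hMv) hε).2
  rw [h1, norm_mul] at h2
  have h5 : 1 ≤ √n * ‖v i‖ := by
    have h6 : √(n * ‖v i‖ ^ 2) = √n * ‖v i‖ := by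
      rw [Real.sqrt_mul (by positivity), Real.sqrt_sq (norm_nonneg _)]
    rw [← h6]
    exact Real.one_le_sqrt.mpr hvi
  calc ‖∑ j, u j * M j i‖ ≤ ‖∑ j, u j * M j i‖ * (√n * ‖v i‖) :=
        le_mul_of_one_le_right (norm_nonneg _) h5
    _ = (‖∑ j, u j * M j i‖ * ‖v i‖) * √n := by ring
    _ ≤ ε * √n := by gcongr

/-- A nearly annihilating vector of a real matrix shifted by a nonreal number has a large
imaginary part. -/
lemma im_sq_le_of_annihilator {B : Matrix (Fin n) (Fin n) ℝ} {R : ℝ} {z : ℂ} {u : Fin n → ℂ}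
    {i : Fin n} {t : ℝ} (hB : ∀ p : Fin n → ℝ, ∑ k, (∑ j, p j * B j k) ^ 2 ≤ R ^ 2 * ∑ j, p j ^ 2)
    (hz : ‖z‖ ≤ 3 * R) (hu : ∑ j, (u j).re ^ 2 + ∑ j, (u j).im ^ 2 = 1)
    (hle : ∑ j, (u j).im ^ 2 ≤ ∑ j, (u j).re ^ 2)
    (huM : ∀ k, k ≠ i → ∑ j, u j * (B.map (fun x : ℝ => (x : ℂ)) - z • 1) j k = 0)
    (hui : ‖∑ j, u j * (B.map (fun x : ℝ => (x : ℂ)) - z • 1) j i‖ ≤ t)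
    (ht : 4 * t ≤ |z.im|) :
    z.im ^ 2 ≤ 100 * R ^ 2 * ∑ j, (u j).im ^ 2 := by
  set P := ∑ j, (u j).re ^ 2 with hP
  set Q := ∑ j, (u j).im ^ 2 with hQ
  have ht0 : 0 ≤ t := (norm_nonneg _).trans hui
  have hsum (k) : ∑ j, u j * (B.map (fun x : ℝ => (x : ℂ)) - z • 1) j k
      = ∑ j, u j * (B j k : ℂ) - z * u k := by
    simp only [Matrix.sub_apply, Matrix.map_apply, Matrix.smul_apply, smul_eq_mul, mul_sub,
      Finset.sum_sub_distrib]
    congr 1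
    simp [Matrix.one_apply, mul_comm]
  set c : Fin n → ℝ := fun k =>
    (∑ j, u j * (B.map (fun x : ℝ => (x : ℂ)) - z • 1) j k).im with hc
  -- The imaginary part of the row identity; since `B` is real, the real part of `u` enters only
  -- through `z.im`. The error `c` is supported at `i`.
  have hck (k) : z.im * (u k).re = ∑ j, (u j).im * B j k - z.re * (u k).im - c k := by
    simp only [hc, hsum, Complex.sub_im, Complex.im_sum, Complex.mul_im, Complex.ofReal_re,
      Complex.ofReal_im, mul_zero, zero_add]
    ring
  have hcsum : ∑ k, c k ^ 2 ≤ t ^ 2 := by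
    rw [Finset.sum_eq_single i]
    · refine sq_le_sq' ?_ ?_
      · exact neg_le_of_abs_le ((Complex.abs_im_le_norm _).trans hui)
      · exact le_of_abs_le ((Complex.abs_im_le_norm _).trans hui)
    · intro k _ hk
      simp only [hc, huM k hk, Complex.zero_im]
      norm_num
    · simp
  have hzre : z.re ^ 2 ≤ 9 * R ^ 2 := by
    have h1 : |z.re| ≤ 3 * R := (Complex.abs_re_le_norm z).trans hz
    have := sq_le_sq' (neg_le_of_abs_le h1) (le_of_abs_le h1)
    linarith
  have hmain : z.im ^ 2 * P ≤ 3 * (R ^ 2 * Q) + 3 * (z.re ^ 2 * Q) + 3 * t ^ 2 := by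
    calc z.im ^ 2 * P = ∑ k, (z.im * (u k).re) ^ 2 := by
          simp only [mul_pow, ← Finset.mul_sum, hP]
      _ ≤ ∑ k, (3 * (∑ j, (u j).im * B j k) ^ 2 + 3 * (z.re ^ 2 * (u k).im ^ 2) + 3 * c k ^ 2) := by
          refine Finset.sum_le_sum fun k _ => ?_
          rw [hck]
          set x := ∑ j, (u j).im * B j k
          nlinarith [sq_nonneg (x + z.re * (u k).im), sq_nonneg (x + c k),
            sq_nonneg (z.re * (u k).im - c k)]
      _ = 3 * ∑ k, (∑ j, (u j).im * B j k) ^ 2 + 3 * (z.re ^ 2 * Q) + 3 * ∑ k, c k ^ 2 := by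
          simp only [Finset.sum_add_distrib, ← Finset.mul_sum, hQ]
      _ ≤ _ := by
          gcongr
          exact hB _
  have hQ0 : 0 ≤ Q := Finset.sum_nonneg fun _ _ => sq_nonneg _
  have ht2 : 16 * t ^ 2 ≤ z.im ^ 2 := by
    rw [← sq_abs z.im]
    nlinarith
  -- With `Q` the squared norm of the imaginary part, `z.im² / 2 ≤ (3 + 27) R² Q + (3 / 16) z.im²`,
  -- so the constant `96` would do.
  have hP2 : 1 / 2 ≤ P := by linarith
  nlinarith [mul_le_mul_of_nonneg_right hzre hQ0, mul_le_mul_of_nonneg_left hP2 (sq_nonneg z.im),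
    mul_nonneg (sq_nonneg R) hQ0]

end Annihilator

/-! ### Conditioning on all columns but one. -/

section Columns
open scoped ENNReal

variable {n : ℕ}

/-- The matrix `A + δ G` where the columns of `√n G` are the vectors `X k`. -/
noncomputable def perturbedMatrix (A : Matrix (Fin n) (Fin n) ℝ) (δ : ℝ) (X : Fin n → Fin n → ℝ) :
    Matrix (Fin n) (Fin n) ℝ :=
  Matrix.of fun j k => A j k + δ * (X k j / √n)

/-- The set of columns for which `A + δ G` has norm at most `R` and `A + δ G - z` nearly kills a
unit vector whose `i`-th entry is at least `1 / √n`. -/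
def nearKernelSet (A : Matrix (Fin n) (Fin n) ℝ) (δ : ℝ) (z : ℂ) (R ε : ℝ) (i : Fin n) :
    Set (Fin n → Fin n → ℝ) :=
  {X | (∀ p : Fin n → ℝ, ∑ k, (∑ j, p j * perturbedMatrix A δ X j k) ^ 2 ≤ R ^ 2 * ∑ j, p j ^ 2) ∧
    ∃ v : Fin n → ℂ, ∑ k, ‖v k‖ ^ 2 = 1 ∧ 1 ≤ n * ‖v i‖ ^ 2 ∧
      ∑ j, ‖(((perturbedMatrix A δ X).map (fun x : ℝ => (x : ℂ)) - z • 1).mulVec v) j‖ ^ 2 ≤ ε ^ 2}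

/-- Supplies the measurability needed for Fubini: the existential over `v` is a projection along the
compact unit sphere, hence preserves closedness. -/
lemma isClosed_nearKernelSet (A : Matrix (Fin n) (Fin n) ℝ) (δ : ℝ) (z : ℂ) (R ε : ℝ)
    (i : Fin n) : IsClosed (nearKernelSet A δ z R ε i) := by
  have hcont (j k : Fin n) : Continuous fun X : Fin n → Fin n → ℝ => perturbedMatrix A δ X j k := by
    unfold perturbedMatrix
    simp only [Matrix.of_apply]
    fun_prop
  rw [nearKernelSet, Set.ofPred_and]
  refine IsClosed.inter ?_ ?_
  · simp only [Set.ofPred_forall]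
    exact isClosed_iInter fun p => isClosed_le (by fun_prop) continuous_const
  · set S : Set (Fin n → ℂ) := {v | ∑ k, ‖v k‖ ^ 2 = 1} with hS
    have hScomp : IsCompact S := by
      refine Metric.isCompact_of_isClosed_isBounded
        (isClosed_eq (by fun_prop) continuous_const) ?_
      refine (Metric.isBounded_closedBall (x := (0 : Fin n → ℂ)) (r := 1)).subset fun v hv => ?_
      rw [mem_closedBall_zero_iff, pi_norm_le_iff_of_nonneg zero_le_one]
      intro k
      have h1 : ‖v k‖ ^ 2 ≤ 1 := by
        rw [← (show ∑ k, ‖v k‖ ^ 2 = 1 from hv)]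
        exact Finset.single_le_sum (f := fun k => ‖v k‖ ^ 2) (fun _ _ => sq_nonneg _)
          (Finset.mem_univ k)
      nlinarith [norm_nonneg (v k)]
    have : CompactSpace S := isCompact_iff_compactSpace.mp hScomp
    set Z : Set (S × (Fin n → Fin n → ℝ)) := {q | 1 ≤ n * ‖q.1.1 i‖ ^ 2} ∩ {q |
      ∑ j, ‖(((perturbedMatrix A δ q.2).map (fun x : ℝ => (x : ℂ)) - z • 1).mulVec q.1.1) j‖ ^ 2
        ≤ ε ^ 2} with hZ
    have hv (k : Fin n) : Continuous fun q : S × (Fin n → Fin n → ℝ) => q.1.1 k :=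
      (continuous_apply k).comp (continuous_subtype_val.comp continuous_fst)
    have hZc : IsClosed Z := by
      refine IsClosed.inter (isClosed_le continuous_const (((hv i).norm.pow 2).const_mul _))
        (isClosed_le ?_ continuous_const)
      refine continuous_finsetSum _ fun j _ => ?_
      simp only [Matrix.mulVec, dotProduct, Matrix.sub_apply, Matrix.map_apply]
      refine (Continuous.norm (continuous_finsetSum _ fun k _ => ?_)).pow 2
      refine Continuous.mul (Continuous.sub ?_ continuous_const) (hv k)
      exact Complex.continuous_ofReal.comp ((hcont j k).comp continuous_snd)
    convert isClosedMap_snd_of_compactSpace Z hZc using 1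
    ext X
    constructor
    · rintro ⟨v, hv1, hv2, hv3⟩
      exact ⟨(⟨v, hv1⟩, X), ⟨hv2, hv3⟩, rfl⟩
    · rintro ⟨⟨v, Y⟩, ⟨h1, h2⟩, rfl⟩
      exact ⟨v.1, v.2, h1, h2⟩

lemma perturbedMatrix_update_of_ne (A : Matrix (Fin n) (Fin n) ℝ) (δ : ℝ) (X : Fin n → Fin n → ℝ)
    {i k : Fin n} (hk : k ≠ i) (y : Fin n → ℝ) (j : Fin n) :
    perturbedMatrix A δ (Function.update X i y) j k = perturbedMatrix A δ X j k := by
  simp [perturbedMatrix, Function.update_of_ne hk]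

/-- The slices of `nearKernelSet` in the direction of the `i`-th column. -/
lemma exists_slice_subset (A : Matrix (Fin n) (Fin n) ℝ) {δ : ℝ} (hδ : 0 < δ) {z : ℂ} {R ε : ℝ}
    (hε : 0 ≤ ε) (hz : ‖z‖ ≤ 3 * R) (hn : 1 ≤ n) (i : Fin n) (X : Fin n → Fin n → ℝ) :
    ∃ p q : Fin n → ℝ, ∃ α β : ℝ, ∑ j, p j ^ 2 + ∑ j, q j ^ 2 = 1 ∧
      ∑ j, q j ^ 2 ≤ ∑ j, p j ^ 2 ∧ ∑ j, p j * q j = 0 ∧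
      ∀ y, Function.update X i y ∈ nearKernelSet A δ z R ε i →
        |∑ j, p j * y j - α| ≤ ε * n / δ ∧ |∑ j, q j * y j - β| ≤ ε * n / δ ∧
        (4 * (ε * √n) ≤ |z.im| → z.im ^ 2 ≤ 100 * R ^ 2 * ∑ j, q j ^ 2) := by
  obtain ⟨u, hu1, hu2, hu3, huM⟩ := exists_annihilator
    ((perturbedMatrix A δ X).map (fun x : ℝ => (x : ℂ)) - z • 1) i
  have hn0 : 0 < √(n : ℝ) := Real.sqrt_pos.mpr (by exact_mod_cast hn)
  have hnn : √(n : ℝ) * √(n : ℝ) = n := Real.mul_self_sqrt (by positivity)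
  -- The deterministic part of the pairing of `u` with column `i`. Since `u` depends only on the
  -- other columns, it and `κ` are the same for every `y` in the slice.
  set κ : ℂ := ∑ j, u j * (A j i : ℂ) - z * u i with hκ
  refine ⟨fun j => (u j).re, fun j => (u j).im, -(κ.re * (√n / δ)), -(κ.im * (√n / δ)),
    hu1, hu2, hu3, fun y hy => ?_⟩
  obtain ⟨hB, v, hv1, hv2, hv3⟩ := hy
  have huM' (k) (hk : k ≠ i) : ∑ j, u j * ((perturbedMatrix A δ (Function.update X i y)).map
      (fun x : ℝ => (x : ℂ)) - z • 1) j k = 0 := by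
    rw [← huM k hk]
    refine Finset.sum_congr rfl fun j _ => ?_
    rw [Matrix.sub_apply, Matrix.sub_apply, Matrix.map_apply, Matrix.map_apply,
      perturbedMatrix_update_of_ne A δ X hk]
  have hunorm : ∑ j, ‖u j‖ ^ 2 = 1 := by
    rw [← hu1, ← Finset.sum_add_distrib]
    exact Finset.sum_congr rfl fun j _ => by rw [Complex.sq_norm, Complex.normSq_apply]; ring
  have hcol := norm_sum_mul_col_le hε hunorm huM' hv2 hv3
  have hsum : ∑ j, u j * ((perturbedMatrix A δ (Function.update X i y)).map
      (fun x : ℝ => (x : ℂ)) - z • 1) j i = κ + ((δ / √n : ℝ) : ℂ) * ∑ j, u j * (y j : ℂ) := by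
    have h1 (j) : u j * ((perturbedMatrix A δ (Function.update X i y)).map
        (fun x : ℝ => (x : ℂ)) - z • 1) j i
        = u j * (A j i : ℂ) - u j * (z * (1 : Matrix (Fin n) (Fin n) ℂ) j i)
          + ((δ / √n : ℝ) : ℂ) * (u j * (y j : ℂ)) := by
      simp only [Matrix.sub_apply, Matrix.map_apply, perturbedMatrix, Matrix.of_apply,
        Function.update_self, Matrix.smul_apply, smul_eq_mul]
      push_cast
      ring
    simp only [h1, Finset.sum_add_distrib, Finset.sum_sub_distrib, ← Finset.mul_sum, hκ]
    congr 2
    simp [Matrix.one_apply, mul_comm]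
  have hscale (x c : ℝ) (h : |c + δ / √n * x| ≤ ε * √n) :
      |x - -(c * (√n / δ))| ≤ ε * n / δ := by
    have h1 : x - -(c * (√n / δ)) = (c + δ / √n * x) * (√n / δ) := by field_simp; ring
    rw [h1, abs_mul, abs_of_pos (by positivity : 0 < √(n : ℝ) / δ)]
    calc _ ≤ ε * √n * (√n / δ) := by gcongr
      _ = ε * (√n * √n) / δ := by ring
      _ = _ := by rw [hnn]
  have hbd := hcol
  rw [hsum] at hbd
  refine ⟨hscale _ _ ?_, hscale _ _ ?_, fun ht => ?_⟩
  · refine le_trans (le_of_eq ?_) ((Complex.abs_re_le_norm _).trans hbd)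
    simp [Complex.re_sum]
  · refine le_trans (le_of_eq ?_) ((Complex.abs_im_le_norm _).trans hbd)
    simp [Complex.im_sum]
  · exact im_sq_le_of_annihilator hB hz hu1 hu2 huM' hcol ht

lemma exists_measure_slice_le : ∃ C : ℝ, 0 < C ∧
    ∀ (μ : Measure ℝ) [IsProbabilityMeasure μ] (K : ℝ), 0 < K → μ ≤ ENNReal.ofReal K • volume →
      ∀ (n : ℕ), 1 ≤ n → ∀ (A : Matrix (Fin n) (Fin n) ℝ) (δ : ℝ), 0 < δ → δ < 1 →
      ∀ (z : ℂ) (R ε : ℝ), 1 ≤ R → 0 < ε → ‖z‖ ≤ 3 * R → z.im ≠ 0 →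
      ∀ (i : Fin n) (X : Fin n → Fin n → ℝ),
        (Measure.pi fun _ : Fin n => μ) {y | Function.update X i y ∈ nearKernelSet A δ z R ε i}
          ≤ ENNReal.ofReal (C * R * (max K (K ^ 2) * n ^ 2 * ε ^ 2 / (δ ^ 2 * |z.im|))) := by
  obtain ⟨C₁, hC₁, hC₁b⟩ := exists_measure_pi_abs_le_div
  obtain ⟨C₂, hC₂, hC₂b⟩ := exists_measure_pi_rectangle_le_div
  refine ⟨8 * C₁ + 20 * C₂, by positivity, ?_⟩
  intro μ _ K hK hμ n hn A δ hδ hδ1 z R ε hR hε hz hzim i X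
  obtain ⟨p, q, α, β, hpq, hle, horth, hsub⟩ := exists_slice_subset A hδ hε.le hz hn i X
  have hy0 : 0 < |z.im| := abs_pos.mpr hzim
  have hn1 : (1 : ℝ) ≤ n := by exact_mod_cast hn
  have hn0 : (0 : ℝ) < n := by linarith
  set s : ℝ := ε * n / δ with hs
  have hs0 : 0 < s := by positivity
  have hs2 : s ^ 2 = n ^ 2 * ε ^ 2 / δ ^ 2 := by rw [hs, div_pow]; ring
  have hQ0 : 0 ≤ ∑ j, q j ^ 2 := Finset.sum_nonneg fun _ _ => sq_nonneg _
  set a : ℝ := √(∑ j, p j ^ 2) with ha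
  set b : ℝ := √(∑ j, q j ^ 2) with hb
  have ha2 : ∑ j, p j ^ 2 = a ^ 2 := (Real.sq_sqrt (by linarith)).symm
  have hb2 : ∑ j, q j ^ 2 = b ^ 2 := (Real.sq_sqrt hQ0).symm
  have hb0 : 0 ≤ b := Real.sqrt_nonneg _
  have hahalf : 1 / 2 ≤ a := by
    refine Real.le_sqrt_of_sq_le ?_
    linarith
  have hba : b ≤ a := Real.sqrt_le_sqrt hle
  have hT : (8 * C₁ + 20 * C₂) * R * (max K (K ^ 2) * n ^ 2 * ε ^ 2 / (δ ^ 2 * |z.im|))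
      = 8 * C₁ * (max K (K ^ 2) * s ^ 2 * (R / |z.im|))
        + 20 * C₂ * (max K (K ^ 2) * s ^ 2 * (R / |z.im|)) := by
    rw [hs2]
    field_simp
  have hT0 : 0 ≤ max K (K ^ 2) * s ^ 2 * (R / |z.im|) := by positivity
  rw [hT]
  -- For small `ε` the imaginary part `q` is long enough for the planar bound. For large `ε` the
  -- single form `p` suffices.
  rcases le_or_gt (4 * (ε * √n)) |z.im| with ht | ht
  -- The lower bound on `q` is read off from any one point of the slice; an empty slice is trivial.
  · by_cases hne : ∃ y, Function.update X i y ∈ nearKernelSet A δ z R ε i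
    swap
    · push Not at hne
      have : {y | Function.update X i y ∈ nearKernelSet A δ z R ε i} = ∅ :=
        Set.eq_empty_of_forall_notMem hne
      rw [this, measure_empty]
      exact zero_le
    obtain ⟨y₀, hy₀⟩ := hne
    have hq := (hsub y₀ hy₀).2.2 ht
    rw [hb2, ← sq_abs z.im] at hq
    have hbz : |z.im| ≤ 10 * R * b := by
      refine (abs_le_of_sq_le_sq' (a := |z.im|) (b := 10 * R * b) ?_ (by positivity)).2
      linarith
    have hbpos : 0 < b := by
      rcases hb0.lt_or_eq with h | h
      · exact h
      · rw [← h] at hbz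
        linarith
    have hsub₂ : {y | Function.update X i y ∈ nearKernelSet A δ z R ε i} ⊆
        {y | |∑ j, p j * y j - α| ≤ s ∧ |∑ j, q j * y j - β| ≤ s} :=
      fun y hy => ⟨(hsub y hy).1, (hsub y hy).2.1⟩
    refine (measure_mono hsub₂).trans
      ((hC₂b (Fin n) μ K hK.le hμ p q α β s a b hs0 hbpos hba ha2 hb2 horth).trans
        (ENNReal.ofReal_le_ofReal ?_))
    have h1 : s / a ≤ 2 * s := by
      rw [div_le_iff₀ (by linarith)]
      calc s = 2 * s * (1 / 2) := by ring
        _ ≤ 2 * s * a := by gcongr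
    have h2 : s / b ≤ 10 * s * (R / |z.im|) := by
      rw [div_le_iff₀ hbpos, mul_div_assoc', div_mul_eq_mul_div, le_div_iff₀ hy0]
      calc s * |z.im| ≤ s * (10 * R * b) := by gcongr
        _ = _ := by ring
    calc C₂ * K ^ 2 * (s / a * (s / b)) ≤ C₂ * max K (K ^ 2) * (2 * s * (10 * s * (R / |z.im|))) := by
          gcongr
          exact le_max_right _ _
      _ = 20 * C₂ * (max K (K ^ 2) * s ^ 2 * (R / |z.im|)) := by ring
      _ ≤ _ := le_add_of_nonneg_left (by positivity)
  · have hsub₁ : {y | Function.update X i y ∈ nearKernelSet A δ z R ε i} ⊆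
        {y | |∑ j, p j * y j - α| ≤ s} := fun y hy => (hsub y hy).1
    refine (measure_mono hsub₁).trans
      ((hC₁b (Fin n) μ K hK.le hμ p α s a hs0 (by linarith) ha2).trans
        (ENNReal.ofReal_le_ofReal ?_))
    have h1 : s / a ≤ 2 * s := by
      rw [div_le_iff₀ (by linarith)]
      calc s = 2 * s * (1 / 2) := by ring
        _ ≤ 2 * s * a := by gcongr
    have h3 : |z.im| ≤ 4 * s := by
      have h4 : √(n : ℝ) ≤ n := by
        rw [Real.sqrt_le_left hn0.le]
        nlinarith
      have h5 : ε * √n ≤ s := by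
        rw [hs, le_div_iff₀ hδ]
        calc ε * √n * δ ≤ ε * n * 1 := by gcongr
          _ = ε * n := mul_one _
      linarith
    -- The lower bound `s ≥ |z.im| / 4` trades the linear estimate for one quadratic in `s`, of the
    -- same shape as in the other case.
    have h2 : s ≤ 4 * (s ^ 2 * (R / |z.im|)) := by
      rw [mul_div_assoc', mul_div_assoc', le_div_iff₀ hy0]
      calc s * |z.im| ≤ s * (4 * s) := by gcongr
        _ = 4 * (s ^ 2 * 1) := by ring
        _ ≤ 4 * (s ^ 2 * R) := by gcongr
    calc C₁ * K * (s / a) ≤ C₁ * max K (K ^ 2) * (2 * (4 * (s ^ 2 * (R / |z.im|)))) := by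
          gcongr
          · exact le_max_left _ _
          · linarith
      _ = 8 * C₁ * (max K (K ^ 2) * s ^ 2 * (R / |z.im|)) := by ring
      _ ≤ _ := le_add_of_nonneg_right (by positivity)

lemma measure_pi_le_of_slice_le {δ : Type*} [Fintype δ] [DecidableEq δ] {Y : δ → Type*}
    [∀ i, MeasurableSpace (Y i)] (μ : ∀ i, Measure (Y i)) [∀ i, IsProbabilityMeasure (μ i)]
    {E : Set (∀ i, Y i)} (hE : MeasurableSet E) (i : δ) {c : ℝ≥0∞}
    (h : ∀ X, μ i {y | Function.update X i y ∈ E} ≤ c) : Measure.pi μ E ≤ c := by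
  have h1 : Measure.pi μ E ≤ ∫⁻ _, c ∂(Measure.pi μ) := by
    rw [← lintegral_indicator_one hE]
    refine lintegral_le_of_lmarginal_le {i} (measurable_one.indicator hE) measurable_const
      fun X => ?_
    rw [lmarginal_singleton, lmarginal_singleton]
    have hT : MeasurableSet {y | Function.update X i y ∈ E} := measurable_update X hE
    simp only [lintegral_const, measure_univ, mul_one]
    refine le_trans (le_of_eq ?_) (h X)
    rw [← lintegral_indicator_one hT]
    rfl
  simpa using h1

end Columns

/-! ### From the least singular value to near-kernel events. -/

section Reduction
open scoped ENNReal

variable {n : ℕ}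

/-- A normalized eigenvector of `T* T` for the eigenvalue `σ²`; this needs the index `n - 1` to be
below the dimension, hence `n ≥ 1`. -/
lemma exists_unit_vector_of_leastSingularValue_le (hn : 1 ≤ n) {M : Matrix (Fin n) (Fin n) ℂ}
    {ε : ℝ} (h : leastSingularValue M ≤ ε) :
    ∃ v : Fin n → ℂ, ∑ k, ‖v k‖ ^ 2 = 1 ∧ ∑ j, ‖(M.mulVec v) j‖ ^ 2 ≤ ε ^ 2 := by
  set T := Matrix.toEuclideanLin M with hT
  set σ := leastSingularValue M with hσ
  have hσ0 : 0 ≤ σ := T.singularValues_nonneg _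
  have hlt : n - 1 < Module.finrank ℂ (EuclideanSpace ℂ (Fin n)) := by
    rw [finrank_euclideanSpace_fin]; omega
  obtain ⟨w, hw⟩ := (T.hasEigenvalue_adjoint_comp_self_sq_singularValues hlt).exists_hasEigenvector
  have hw0 : 0 < ‖w‖ := norm_pos_iff.mpr hw.2
  have hTw : ‖T w‖ ^ 2 = σ ^ 2 * ‖w‖ ^ 2 := by
    have h1 : (inner ℂ (T w) (T w) : ℂ) = (σ ^ 2 : ℝ) * inner ℂ w w := by
      have h2 := hw.apply_eq_smul
      rw [LinearMap.comp_apply] at h2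
      rw [← LinearMap.adjoint_inner_right, h2, inner_smul_right]
      simp [hσ, leastSingularValue, hT]
    rw [inner_self_eq_norm_sq_to_K, inner_self_eq_norm_sq_to_K] at h1
    refine Complex.ofReal_injective ?_
    simpa using h1
  have hTv (v : EuclideanSpace ℂ (Fin n)) (j) : (T v) j = (M.mulVec v.ofLp) j := by
    simp [hT, Matrix.toLpLin_apply]
  set v : EuclideanSpace ℂ (Fin n) := ((‖w‖⁻¹ : ℝ) : ℂ) • w with hv
  have hvnorm : ‖v‖ = 1 := by
    rw [hv, norm_smul, Complex.norm_real, norm_inv, norm_norm, inv_mul_cancel₀ hw0.ne']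
  have hTvnorm : ‖T v‖ ^ 2 = σ ^ 2 := by
    rw [hv, map_smul, norm_smul, Complex.norm_real, norm_inv, norm_norm, mul_pow, hTw]
    field_simp
  refine ⟨v.ofLp, ?_, ?_⟩
  · rw [← EuclideanSpace.norm_sq_eq, hvnorm, one_pow]
  · simp only [← hTv]
    rw [← EuclideanSpace.norm_sq_eq, hTvnorm]
    gcongr

lemma sum_sq_vecMul_le (B : Matrix (Fin n) (Fin n) ℝ) {R : ℝ} (hR : ‖B‖ ≤ R) (p : Fin n → ℝ) :
    ∑ k, (∑ j, p j * B j k) ^ 2 ≤ R ^ 2 * ∑ j, p j ^ 2 := by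
  have h1 := Matrix.l2_opNorm_mulVec (Matrix.conjTranspose B) (WithLp.toLp 2 p)
  rw [Matrix.l2_opNorm_conjTranspose] at h1
  have h2 : ∑ j, p j ^ 2 = ‖WithLp.toLp 2 p‖ ^ 2 := by
    rw [EuclideanSpace.norm_sq_eq]
    simp
  have h3 : ∑ k, (∑ j, p j * B j k) ^ 2
      = ‖WithLp.toLp 2 ((Matrix.conjTranspose B).mulVec p)‖ ^ 2 := by
    rw [EuclideanSpace.norm_sq_eq]
    simp [Matrix.mulVec, dotProduct, mul_comm]
  rw [h2, h3, ← mul_pow]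
  have h0 : 0 ≤ ‖B‖ := norm_nonneg B
  refine pow_le_pow_left₀ (norm_nonneg _) (h1.trans ?_) 2
  gcongr

lemma exists_one_le_mul_norm_sq (hn : 1 ≤ n) {v : Fin n → ℂ} (hv : ∑ k, ‖v k‖ ^ 2 = 1) :
    ∃ i, 1 ≤ n * ‖v i‖ ^ 2 := by
  by_contra! h
  have hn0 : (0 : ℝ) < n := by exact_mod_cast hn
  have : Nonempty (Fin n) := ⟨⟨0, hn⟩⟩
  have h1 : ∑ k : Fin n, n * ‖v k‖ ^ 2 < ∑ k : Fin n, (1 : ℝ) :=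
    Finset.sum_lt_sum_of_nonempty Finset.univ_nonempty fun k _ => h k
  rw [← Finset.mul_sum, hv] at h1
  simp at h1

/-- The columns of a matrix with i.i.d. entries are i.i.d. vectors. -/
lemma map_columns_eq_pi (hn : 1 ≤ n) {Ω Ω' : Type*} [MeasurableSpace Ω] [MeasurableSpace Ω'] {P : Measure Ω}
    {P' : Measure Ω'} [IsProbabilityMeasure P] [IsProbabilityMeasure P'] {ξ : Ω' → ℝ}
    {G : Ω → Matrix (Fin n) (Fin n) ℝ} (hG : IsScaledIIDMatrix G P ξ P') :
    P.map (fun ω k j => √(n : ℝ) * G ω j k)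
      = Measure.pi fun _ : Fin n => Measure.pi fun _ : Fin n => P'.map ξ := by
  have hξ : AEMeasurable ξ P' := (hG.copies ⟨0, hn⟩ ⟨0, hn⟩).aemeasurable_snd
  have : IsProbabilityMeasure (P'.map ξ) := Measure.isProbabilityMeasure_map hξ
  have haem (p : Fin n × Fin n) : AEMeasurable (fun ω => √(n : ℝ) * G ω p.1 p.2) P :=
    (hG.copies p.1 p.2).aemeasurable_fst
  have h1 := (iIndepFun_iff_map_fun_eq_pi_map haem).mp hG.indep
  simp only [(hG.copies _ _).map_eq] at h1
  set T : (Fin n × Fin n → ℝ) → (Fin n → Fin n → ℝ) := fun x k j => x (j, k) with hT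
  set T' : (Fin n → Fin n → ℝ) → (Fin n × Fin n → ℝ) := fun X p => X p.2 p.1 with hT'
  have hTm : Measurable T := by fun_prop
  have hTm' : Measurable T' := by fun_prop
  have h2 : (Measure.pi fun _ : Fin n × Fin n => P'.map ξ) =
      (Measure.pi fun _ : Fin n => Measure.pi fun _ : Fin n => P'.map ξ).map T' := by
    refine Measure.pi_eq fun s hs => ?_
    rw [Measure.map_apply hTm' (MeasurableSet.univ_pi hs)]
    have : T' ⁻¹' Set.univ.pi s = Set.univ.pi fun k => Set.univ.pi fun j => s (j, k) := by
      ext X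
      simp only [hT', Set.mem_preimage, Set.mem_univ_pi, Prod.forall]
      exact forall_comm
    rw [this, Measure.pi_pi]
    simp only [Measure.pi_pi]
    rw [Fintype.prod_prod_type_right]
  have h3 : P.map (fun ω k j => √(n : ℝ) * G ω j k)
      = (P.map fun ω (p : Fin n × Fin n) => √(n : ℝ) * G ω p.1 p.2).map T := by
    rw [AEMeasurable.map_map_of_aemeasurable hTm.aemeasurable (aemeasurable_pi_lambda _ haem)]
    rfl
  rw [h3, h1, h2, Measure.map_map hTm hTm']
  exact Measure.map_id

/-- The bound for positive `ε` and nonnegative `K'`. -/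
lemma exists_measureReal_le_of_pos : ∃ c : ℝ, 0 < c ∧
    ∀ (Ω Ω' : Type*) [MeasurableSpace Ω] [MeasurableSpace Ω']
      (P : Measure Ω) (P' : Measure Ω') [IsProbabilityMeasure P] [IsProbabilityMeasure P']
      (ξ : Ω' → ℝ) (K : ℝ), HasDensityBoundedBy ξ P' K →
    ∀ (n : ℕ), 1 ≤ n →
    ∀ (G : Ω → Matrix (Fin n) (Fin n) ℝ), IsScaledIIDMatrix G P ξ P' →
    ∀ (A : Matrix (Fin n) (Fin n) ℝ), ‖A‖ ≤ 1 →
    ∀ (δ : ℝ), 0 < δ → δ < 1 →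
    ∀ (K' : ℝ) (z : ℂ), 0 ≤ K' → ‖z‖ ≤ 3 * δ * K' + 3 → z.im ≠ 0 →
    ∀ (ε : ℝ), 0 < ε →
      P.real {ω | ‖G ω‖ ≤ K' ∧
          leastSingularValue
            ((A + δ • G ω).map (fun x : ℝ => (x : ℂ)) - z • (1 : Matrix (Fin n) (Fin n) ℂ)) ≤ ε}
        ≤ c * (1 + δ * K') * (max K (K ^ 2) * (n : ℝ) ^ 3 * ε ^ 2 / (δ ^ 2 * |z.im|)) := by
  obtain ⟨C, hC, hCb⟩ := exists_measure_slice_le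
  refine ⟨C, hC, ?_⟩
  intro Ω Ω' _ _ P P' _ _ ξ K hξ n hn G hG A hA δ hδ hδ1 K' z hK' hz hzim ε hε
  obtain ⟨hξm, f, _, hfK, hmap⟩ := hξ
  have hprob : IsProbabilityMeasure (P'.map ξ) := Measure.isProbabilityMeasure_map hξm
  have hμ : P'.map ξ ≤ ENNReal.ofReal K • volume := by
    rw [hmap, ← withDensity_const]
    exact withDensity_mono (ae_of_all _ fun x => ENNReal.ofReal_le_ofReal (hfK x).2)
  -- A probability law cannot be dominated by the zero measure.
  have hK : 0 < K := by
    by_contra! h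
    have h1 := hμ Set.univ
    rw [measure_univ, ENNReal.ofReal_of_nonpos h, zero_smul] at h1
    simp at h1
  set R : ℝ := 1 + δ * K' with hR
  have hR1 : 1 ≤ R := by
    rw [hR]
    have : 0 ≤ δ * K' := by positivity
    linarith
  set X : Ω → Fin n → Fin n → ℝ := fun ω k j => √(n : ℝ) * G ω j k with hX
  have hn0 : (0 : ℝ) < √n := Real.sqrt_pos.mpr (by exact_mod_cast hn)
  have hB (ω) : perturbedMatrix A δ (X ω) = A + δ • G ω := by
    ext j k
    simp only [perturbedMatrix, hX, Matrix.of_apply, Matrix.add_apply, Matrix.smul_apply,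
      smul_eq_mul]
    rw [mul_div_cancel_left₀ _ hn0.ne']
  have hXm : AEMeasurable X P := by
    refine aemeasurable_pi_lambda _ fun k => aemeasurable_pi_lambda _ fun j => ?_
    exact (hG.copies j k).aemeasurable_fst
  set t : ℝ := C * R * (max K (K ^ 2) * n ^ 2 * ε ^ 2 / (δ ^ 2 * |z.im|)) with ht
  have ht0 : 0 ≤ t := by positivity
  have hsub : {ω | ‖G ω‖ ≤ K' ∧ leastSingularValue ((A + δ • G ω).map (fun x : ℝ => (x : ℂ)) -
      z • (1 : Matrix (Fin n) (Fin n) ℂ)) ≤ ε} ⊆ X ⁻¹' ⋃ i, nearKernelSet A δ z R ε i := by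
    rintro ω ⟨hω1, hω2⟩
    obtain ⟨v, hv1, hv2⟩ := exists_unit_vector_of_leastSingularValue_le hn hω2
    obtain ⟨i, hi⟩ := exists_one_le_mul_norm_sq hn hv1
    refine Set.mem_iUnion.mpr ⟨i, ?_, v, hv1, hi, ?_⟩
    · refine sum_sq_vecMul_le _ ?_
      rw [hB]
      calc ‖A + δ • G ω‖ ≤ ‖A‖ + ‖δ • G ω‖ := norm_add_le _ _
        _ = ‖A‖ + δ * ‖G ω‖ := by rw [norm_smul, Real.norm_eq_abs, abs_of_pos hδ]
        _ ≤ R := by rw [hR]; gcongr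
    · rw [hB]
      exact hv2
  have hmeas : P {ω | ‖G ω‖ ≤ K' ∧ leastSingularValue ((A + δ • G ω).map (fun x : ℝ => (x : ℂ)) -
      z • (1 : Matrix (Fin n) (Fin n) ℂ)) ≤ ε} ≤ ENNReal.ofReal (n * t) := by
    calc _ ≤ P (X ⁻¹' ⋃ i, nearKernelSet A δ z R ε i) := measure_mono hsub
      _ ≤ P.map X (⋃ i, nearKernelSet A δ z R ε i) := Measure.le_map_apply hXm _
      _ ≤ ∑ i, P.map X (nearKernelSet A δ z R ε i) := measure_iUnion_fintype_le _ _
      _ ≤ ∑ _i : Fin n, ENNReal.ofReal t := by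
          refine Finset.sum_le_sum fun i _ => ?_
          rw [map_columns_eq_pi hn hG]
          refine measure_pi_le_of_slice_le _ (isClosed_nearKernelSet A δ z R ε i).measurableSet i
            fun Y => ?_
          exact hCb _ K hK hμ n hn A δ hδ hδ1 z R ε hR1 hε (by rw [hR]; linarith) hzim i Y
      _ = _ := by
          rw [Finset.sum_const, Finset.card_univ, Fintype.card_fin, nsmul_eq_mul,
            ENNReal.ofReal_mul (p := (n : ℝ)) (by positivity), ENNReal.ofReal_natCast]
  refine (ENNReal.toReal_le_of_le_ofReal (by positivity) hmeas).trans (le_of_eq ?_)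
  rw [ht]
  ring

end Reduction

/-! ### The theorem for arbitrary real `ε` and `K'`. -/

theorem mainTheorem5 :
    ∃ c : ℝ, 0 < c ∧
      ∀ (Ω Ω' : Type*) [MeasurableSpace Ω] [MeasurableSpace Ω']
        (P : Measure Ω) (P' : Measure Ω') [IsProbabilityMeasure P] [IsProbabilityMeasure P']
        (ξ : Ω' → ℝ) (K : ℝ), IsSubGaussian ξ P' → HasDensityBoundedBy ξ P' K →
      ∀ (n : ℕ), 1 ≤ n →
      ∀ (G : Ω → Matrix (Fin n) (Fin n) ℝ), IsScaledIIDMatrix G P ξ P' →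
      ∀ (A : Matrix (Fin n) (Fin n) ℝ), ‖A‖ ≤ 1 →
      ∀ (δ : ℝ), 0 < δ → δ < 1 →
      ∀ (K' : ℝ) (z : ℂ), ‖z‖ ≤ 3 * δ * K' + 3 → z.im ≠ 0 →
      ∀ (ε : ℝ),
        P.real {ω | ‖G ω‖ ≤ K' ∧
            leastSingularValue
              ((A + δ • G ω).map (fun x : ℝ => (x : ℂ)) - z • (1 : Matrix (Fin n) (Fin n) ℂ)) ≤ ε}
          ≤ c * (1 + δ * K') * (max K (K ^ 2) * (n : ℝ) ^ 3 * ε ^ 2 / (δ ^ 2 * |z.im|)) := by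
  obtain ⟨c, hc, hcb⟩ := exists_measureReal_le_of_pos
  refine ⟨c, hc, ?_⟩
  intro Ω Ω' _ _ P P' _ _ ξ K _ hξ n hn G hG A hA δ hδ hδ1 K' z hz hzim ε
  have hmain := hcb Ω Ω' P P' ξ K hξ n hn G hG A hA δ hδ hδ1 K' z
  have hrhs : 0 ≤ c * (1 + δ * K') * (max K (K ^ 2) * (n : ℝ) ^ 3 * ε ^ 2 / (δ ^ 2 * |z.im|)) := by
    -- For negative `K'` this still holds, because `0 ≤ ‖z‖ ≤ 3 (1 + δ K')`.
    have h1 : 0 ≤ 1 + δ * K' := by linarith [norm_nonneg z]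
    have h2 : 0 ≤ max K (K ^ 2) := le_max_of_le_right (sq_nonneg K)
    positivity
  have hempty (h : ∀ ω, ¬ (‖G ω‖ ≤ K' ∧ leastSingularValue ((A + δ • G ω).map
      (fun x : ℝ => (x : ℂ)) - z • (1 : Matrix (Fin n) (Fin n) ℂ)) ≤ ε)) :
      P.real {ω | ‖G ω‖ ≤ K' ∧ leastSingularValue ((A + δ • G ω).map (fun x : ℝ => (x : ℂ)) -
        z • (1 : Matrix (Fin n) (Fin n) ℂ)) ≤ ε}
        ≤ c * (1 + δ * K') * (max K (K ^ 2) * (n : ℝ) ^ 3 * ε ^ 2 / (δ ^ 2 * |z.im|)) := by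
    rw [Set.eq_empty_of_forall_notMem (s := {ω | ‖G ω‖ ≤ K' ∧ _}) h, measureReal_empty]
    exact hrhs
  rcases lt_or_ge K' 0 with hK' | hK'
  · exact hempty fun ω h => absurd (h.1.trans_lt hK') (norm_nonneg _).not_gt
  rcases lt_trichotomy ε 0 with hε | hε | hε
  · exact hempty fun ω h => absurd (h.2.trans_lt hε) (LinearMap.singularValues_nonneg _ _).not_gt
  -- At `ε = 0` the event lies in the event for every `e > 0`, and the bound is continuous in `e`.
  · have hlim : Filter.Tendsto (fun e : ℝ => c * (1 + δ * K') *
        (max K (K ^ 2) * (n : ℝ) ^ 3 * e ^ 2 / (δ ^ 2 * |z.im|))) (nhdsWithin ε (Set.Ioi ε))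
        (nhds (c * (1 + δ * K') * (max K (K ^ 2) * (n : ℝ) ^ 3 * ε ^ 2 / (δ ^ 2 * |z.im|)))) :=
      (by fun_prop : Continuous _).continuousWithinAt
    refine ge_of_tendsto hlim ?_
    filter_upwards [self_mem_nhdsWithin] with e he
    refine le_trans ?_ (hmain hK' hz hzim e (hε ▸ he))
    exact measureReal_mono fun ω h => ⟨h.1, h.2.trans (le_of_lt he)⟩
  · exact hmain hK' hz hzim ε hε
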